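/- Let $\kappa\ge 1$ and $k=2\kappa+1$. For an order-$k$ tensor $\mathbf A\in\mathbb R^{[n]^k}$ put $\|\mathbf A\|_{inj}=\max_{\|x\|_2=1}|\langle \mathbf A,x^{\otimes k}\rangle|$. For a parameter $d\ge 1$ the algorithm does the following. 1. Form $\mathbf A'$: if $S\in[n]^k$ is lexicographically first among its rearrangements (i.e. nondecreasing), $\mathbf A'_S$ is the sum of $\mathbf A_R$ over all distinct rearrangements $R$ of $S$; otherwise $\mathbf A'_S=0$. 2. Let $A_i$ be the $n^\kappa\times n^\kappa$ matrix $A_i(I,J)=\mathbf A'_{(i,I,J)}$ and $M=\sum_{i\in[n]}A_i\otimes A_i$. 3. Let $N_{(I_1,I_2),(J_1,J_2)}=M_{(I_1,I_2),(J_1,J_2)}$ if $(I_1,J_1)\ne(I_2,J_2)$, and $0$ otherwise. 4. Let $C_d=\mathbb E_{\Pi,\Sigma}[\Pi N^{\otimes d}\Sigma]$, where $\Pi,\Sigma$ are independent uniformly random elements of $\mathcal S_{2d\kappa}$, acting by permuting the $2d\kappa$ coordinates of the row (respectively column) indices in $[n]^{2d\kappa}$. 5. Output $\mathrm{out}_d(\mathbf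 A)=\bigl(\|C_d\|^{1/d}+\max_{a,b\in[n]^\kappa}\sum_{i\in[n]}A_i(a,b)^2\bigr)^{1/2}$, where $\|\cdot\|$ is the spectral norm. Then: (1) For every $n$, every $d\ge1$ and every symmetric order-$k$ tensor $\mathbf A$ of dimension $n$, $\|\mathbf A\|_{inj}\le \mathrm{out}_d(\mathbf A)$. (2) For every $v\ge0$ there is a constant $C=C(k,v)>0$ such that the following holds. Let $d=d(n)\ge1$ be integers with $d\log n=o(n^{1/120})$, and for each $n$ let $\mathbf A$ be a random symmetric order-$k$ tensor of dimension $n$ whose entries at nondecreasing multi-indices are independent and all of whose entries are centered and subgaussian with variance proxy $v$ (that is, $\mathbb E\,e^{tX}\le e^{vt^2/2}$ for all real $t$); the entries need not be identically distributed. Then, with probability tending to $1$ as $n\to\infty$, $$\mathrm{out}_d(\mathbf A)\le C(\log n)^C\cdot\frac{n^{k/4}}{d^{(k-2)/4}}\cdot d^{\frac{k^2\log d}{2\log n}},$$ so the algorithm certifies this bound on $\|\mathbf A\|_{inj}$. (3) For every $v\ge0$ and $0<\beta<1/30$ there is a constant $C=C(k,v,\beta)>0$ such that for all integers $d=d(n)\ge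 1$ with $k\,d\log n<4n^{\beta/4}$ for all large $n$, and random tensors as in (2), with probability tending to $1$ as $n\to\infty$, $$\|C_d\|\le\Bigl(C(\log n)^C\cdot\frac{n^{k/2}}{d^{(k-2)/2-4\kappa^2\beta}}\Bigr)^d .$$ -/

import Mathlib

open scoped NNReal Kronecker

namespace OddTensor

/-- Real tensors of order `k` and dimension `n`: one entry for every multi-index in `[n]^k`. -/
abbrev Tensor (k n : ℕ) : Type := (Fin k → Fin n) → ℝ

/-- A tensor is symmetric if its entries do not change when the indices are permuted. -/
def IsSymmetric {k n : ℕ} (T : Tensor k n) : Prop :=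
  ∀ (π : Equiv.Perm (Fin k)) (S : Fin k → Fin n), T (S ∘ π) = T S

/-- The inner product `⟨T, x^{⊗k}⟩`. -/
def evalPow {k n : ℕ} (T : Tensor k n) (x : EuclideanSpace ℝ (Fin n)) : ℝ :=
  ∑ S : Fin k → Fin n, T S * ∏ j, x (S j)

/-- The injective norm: the maximum of `|⟨T, x^{⊗k}⟩|` over Euclidean unit vectors `x`. -/
noncomputable def injNorm {k n : ℕ} (T : Tensor k n) : ℝ :=
  ⨆ x : Metric.sphere (0 : EuclideanSpace ℝ (Fin n)) 1, |evalPow T x|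

/-- The asymmetrization of a tensor. A multi-index is lexicographically first among its
rearrangements exactly when it is nondecreasing; such an entry receives the sum of the entries of
`T` over all distinct rearrangements of the multi-index, every other entry is set to zero. -/
noncomputable def asymmetrize {k n : ℕ} (T : Tensor k n) : Tensor k n := by
  classical
  exact fun S =>
    if Monotone S then
      ∑ R ∈ Finset.univ.image (fun π : Equiv.Perm (Fin k) => S ∘ π), T R
    else 0

/-- The matrix flattening of the `i`-th slice of a tensor of order `2κ+1`: its `(I, J)` entry is the
entry of `T` at the multi-index `(i, I, J)`. -/
def slice {κ n : ℕ} (T : Tensor (2 * κ + 1) n) (i : Fin n) :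
    Matrix (Fin κ → Fin n) (Fin κ → Fin n) ℝ :=
  Matrix.of fun I J =>
    T ((Fin.cons i (Fin.append I J) : Fin (κ + κ + 1) → Fin n) ∘ Fin.cast (by omega))

/-- `M = ∑ i, A_i ⊗ A_i`, where the `A_i` are the slices of the asymmetrization of `T`. -/
noncomputable def sumKron {κ n : ℕ} (T : Tensor (2 * κ + 1) n) :
    Matrix ((Fin κ → Fin n) × (Fin κ → Fin n)) ((Fin κ → Fin n) × (Fin κ → Fin n)) ℝ :=
  ∑ i : Fin n, slice (asymmetrize T) i ⊗ₖ slice (asymmetrize T) i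

/-- `N`: the matrix `M` with its entries at rows `(I₁, I₂)` and columns `(J₁, J₂)` such that
`(I₁, J₁) = (I₂, J₂)` replaced by zero. -/
noncomputable def diagFree {κ n : ℕ} (T : Tensor (2 * κ + 1) n) :
    Matrix ((Fin κ → Fin n) × (Fin κ → Fin n)) ((Fin κ → Fin n) × (Fin κ → Fin n)) ℝ :=
  Matrix.of fun I J => if (I.1, J.1) ≠ (I.2, J.2) then sumKron T I J else 0

/-- The `2dκ` index positions of a row or a column of a `d`-th tensor power: the number of the
factor, the half (`0` for `I₁`, `1` for `I₂`), and the place within that half. -/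
abbrev Pos (κ d : ℕ) : Type := Fin d × Fin 2 × Fin κ

/-- The part of a multi-index in `[n]^{2dκ}` that belongs to the `j`-th tensor factor. -/
def block {κ d n : ℕ} (U : Pos κ d → Fin n) (j : Fin d) : (Fin κ → Fin n) × (Fin κ → Fin n) :=
  (fun t => U (j, 0, t), fun t => U (j, 1, t))

/-- The `d`-th tensor (Kronecker) power, with rows and columns indexed by `[n]^{2dκ}`. -/
def tensorPow {κ n : ℕ} (d : ℕ)
    (N : Matrix ((Fin κ → Fin n) × (Fin κ → Fin n)) ((Fin κ → Fin n) × (Fin κ → Fin n)) ℝ) :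
    Matrix (Pos κ d → Fin n) (Pos κ d → Fin n) ℝ :=
  Matrix.of fun U V => ∏ j : Fin d, N (block U j) (block V j)

/-- The average of `Π W Σ` over independent uniformly random `Π`, `Σ`, each of them permuting the
index positions (of the rows, respectively of the columns) by an element of the symmetric group. -/
noncomputable def symmetrize {P α : Type} [Fintype P] [DecidableEq P]
    (W : Matrix (P → α) (P → α) ℝ) : Matrix (P → α) (P → α) ℝ :=
  ((Fintype.card (Equiv.Perm P) : ℝ) ^ 2)⁻¹ •
    ∑ π : Equiv.Perm P, ∑ σ : Equiv.Perm P,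
      W.submatrix (fun U : P → α => U ∘ π) (fun V : P → α => V ∘ σ)

/-- The certificate matrix `C_d`. -/
noncomputable def certMatrix {κ n : ℕ} (d : ℕ) (T : Tensor (2 * κ + 1) n) :
    Matrix (Pos κ d → Fin n) (Pos κ d → Fin n) ℝ :=
  symmetrize (tensorPow d (diagFree T))

/-- The spectral norm (largest singular value) of a square real matrix. -/
noncomputable def specNorm {ι : Type} [Fintype ι] [DecidableEq ι] (B : Matrix ι ι ℝ) : ℝ :=
  ‖Matrix.toEuclideanCLM (n := ι) (𝕜 := ℝ) B‖

/-- The output of the algorithm on the tensor `T` with parameter `d`: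
`(‖C_d‖^{1/d} + max_{a,b} ∑ i, A_i(a,b)^2)^{1/2}`. -/
noncomputable def certify {κ n : ℕ} (d : ℕ) (T : Tensor (2 * κ + 1) n) : ℝ :=
  Real.sqrt (specNorm (certMatrix d T) ^ (1 / (d : ℝ)) +
    ⨆ ab : (Fin κ → Fin n) × (Fin κ → Fin n),
      ∑ i : Fin n, slice (asymmetrize T) i ab.1 ab.2 ^ 2)

/-- A random symmetric tensor with independent centered subgaussian entries with variance proxy
`v`. Independence is that of the entries at the nondecreasing multi-indices, which determine the
tensor. `HasSubgaussianMGF X v P` says `𝔼 exp(tX) ≤ exp(v t² / 2)` for all real `t`; this forces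
`𝔼 X = 0`, and for centered variables it is the usual subgaussian condition. -/
structure IsRandomTensor {Ω : Type*} [MeasurableSpace Ω] (P : MeasureTheory.Measure Ω)
    {k n : ℕ} (v : ℝ≥0) (A : Ω → Tensor k n) : Prop where
  symmetric : ∀ ω, IsSymmetric (A ω)
  indep : ProbabilityTheory.iIndepFun
    (fun (S : {S : Fin k → Fin n // Monotone S}) (ω : Ω) => A ω S.1) P
  subgaussian : ∀ S : Fin k → Fin n,
    ProbabilityTheory.HasSubgaussianMGF (fun ω => A ω S) v P

end OddTensor

/-!
# Certifying the injective norm of tensors of odd order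

Write `A_i` for the slices of the asymmetrized tensor, `N` for the diagonal-free part of
`∑ i, A_i ⊗ A_i`, and `C_d` for the symmetrized `d`-th tensor power of `N`.

**The upper bound.** For a unit vector `x` one has `⟨T, x^{⊗k}⟩ = ∑ i, x_i ⟨x^{⊗κ}, A_i x^{⊗κ}⟩`,
and by Cauchy–Schwarz its square is at most `∑ i, ⟨x^{⊗κ}, A_i x^{⊗κ}⟩²`, the quadratic form of
`∑ i, A_i ⊗ A_i` at `x^{⊗2κ}`. The entries removed in `N` contribute a convex combination of the
numbers `∑ i, A_i(a,b)²`, and the `d`-th power of the quadratic form of `N` is that of `N^{⊗d}` at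
`x^{⊗2dκ}`, which does not notice the averaging over permutations of the positions
(`injNorm_le_certify`).

**The trace.** The rest is a bound on `‖C_d‖` by the moment method. For a power of two `L` of the
order of `log n`, `‖C_d‖^L ≤ tr (C_d C_dᵀ)^{L/2}` (`specNorm_pow_le_trace`). Since
`C_d = Π N^{⊗d} Π` with `Π` the average of all permutations of the positions, the trace is an
average over permutations `π_t`, `t < L`, of a sum over sequences `V_0, …, V_L` of multi-indices
and over slice indices `i_{t,j}` of a product of entries of the tensor, one for each *factor*
`(t, j, h)` with `t < L`, `j < d` and `h` one of the two Kronecker halves (`trace_expansion`). Such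
a *word* has expectation zero unless each of its entries occurs at least twice.

**The count.** For a word all of whose entries are repeated, let `rep` send every factor to the
earliest factor with the same entry; call the fixed points new and the others old. The sum over
words is bounded by a sum over the possible `rep`, the slice indices and the pairs `(π, V)` for
which every factor carries the labels of its representative. Fix `rep`, and average over replacing
`π` by `π τ`, where `τ_t` permutes the positions that belong to old factors. For fixed `π`:

* `V` is determined by its *birth labels*, those of `V_0` and those leaving the new factors
  (`eq_of_birth_eq`), whatever `τ` is;
* for a given `V`, the number of admissible `τ` is at most `∏ a, O_a!`, where `O_a` counts how
  often the label `a` enters an old factor. A label that leaves the factors of one step enters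
  those of the next. Comparing the two counts, a label `a` which is born `B_a` times has
  `2 O_a ≤ 2 B_a + ex_a`, where `ex_a` comes only from the entries that occur at least three times
  (`two_mul_sum_old_le`). So `∏ a, O_a!` is essentially at most `∏ a, B_a!`;
* the sum of `∏ a, B_a!` over all choices of `s` birth labels is the rising factorial
  `n (n + 1) ⋯ (n + s - 1)`, of the order of `n ^ s`.

The number of the permutations `τ` over which the average is taken is about `(κ d)!` for each step,
and dividing by it produces the gain in `d`. Each entry which occurs more than twice costs a
bounded power of `κ L d` and saves a power of `n`, so that only the words whose entries occur
exactly twice matter once `n` exceeds a fixed power of `κ L d`. The condition `V_0 = V_L` is not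
used: giving it up costs a factor `n ^ (2 κ d)`, harmless since `L` is at least `log n`. As the
diagonal was removed from `N`, the two factors of a pair `(t, j)` have different entries, so that
every slice index is shared by two pairs, and the sum over the slice indices is at most of the
order of `(n L d) ^ (L d / 2)` (`sum_slice_weight_le`).

Altogether `𝔼 tr (C_d C_dᵀ)^{L/2}` is at most the `(L d / 2)`-th power of a constant times
`L n ^ k / d ^ (k - 2)`, and Markov's inequality gives `measure_specNorm_gt_le`. This is stronger
than both probabilistic bounds claimed for `‖C_d‖`; the term `max ∑ i, A_i(a,b)²` is at most of the
order of `n log² n` by a union bound over the entries.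
-/

namespace OddTensor

open Finset

/-! ### Factorials and fibres of labellings -/

/-- The total weight `∏ a, |β⁻¹(a)|!` over all labellings of a set of size `s` by `n` labels is the
rising factorial `n (n + 1) ⋯ (n + s - 1)`. -/
theorem sum_prod_factorial_card_fiber_fin (n s : ℕ) :
    ∑ β : Fin s → Fin n, ∏ a, (#{x | β x = a}).factorial = n.ascFactorial s := by
  induction s with
  | zero => simp
  | succ s ih =>
    rw [← (Fin.consEquiv fun _ : Fin (s + 1) => Fin n).sum_comp, Fintype.sum_prod_type_right]
    have hcard : ∀ (v : Fin n) (β : Fin s → Fin n) (a : Fin n),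
        #{x | (Fin.cons v β : Fin (s + 1) → Fin n) x = a}
          = #{x | β x = a} + if v = a then 1 else 0 := by
      intro v β a
      simp only [card_filter, Fin.sum_univ_succ, Fin.cons_zero, Fin.cons_succ]
      ring
    have hprod : ∀ (v : Fin n) (β : Fin s → Fin n),
        ∏ a, (#{x | (Fin.cons v β : Fin (s + 1) → Fin n) x = a}).factorial
          = (#{x | β x = v} + 1) * ∏ a, (#{x | β x = a}).factorial := by
      intro v β
      rw [← mul_prod_erase univ _ (mem_univ v),
        ← mul_prod_erase univ (fun a => (#{x | β x = a}).factorial) (mem_univ v), hcard, if_pos rfl,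
        Nat.factorial_succ, mul_assoc]
      congr 2
      refine prod_congr rfl fun a ha => ?_
      rw [hcard, if_neg (ne_of_mem_erase ha).symm, add_zero]
    have hsum : ∀ β : Fin s → Fin n, ∑ v, (#{x | β x = v} + 1) = n + s := by
      intro β
      rw [sum_add_distrib, ← card_eq_sum_card_fiberwise (f := β) (t := univ) (by simp)]
      simp [add_comm]
    calc _ = ∑ β : Fin s → Fin n, ∑ v, (#{x | β x = v} + 1) * ∏ a, (#{x | β x = a}).factorial :=
          sum_congr rfl fun β _ => sum_congr rfl fun v _ => hprod v β
      _ = ∑ β : Fin s → Fin n, (n + s) * ∏ a, (#{x | β x = a}).factorial := by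
          refine sum_congr rfl fun β _ => ?_
          rw [← sum_mul, hsum]
      _ = _ := by rw [← mul_sum, ih, Nat.ascFactorial_succ]

/-- The rising factorial of `sum_prod_factorial_card_fiber_fin`, bounded by a power, for an
arbitrary index type. -/
theorem sum_prod_factorial_card_fiber_le {S : Type*} [Fintype S] [DecidableEq S] (n : ℕ) :
    ∑ β : S → Fin n, ∏ a, (#{x | β x = a}).factorial
      ≤ (n + Fintype.card S) ^ Fintype.card S := by
  have e := Fintype.equivFin S
  have h : ∑ β : S → Fin n, ∏ a, (#{x | β x = a}).factorial
      = n.ascFactorial (Fintype.card S) := by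
    rw [← sum_prod_factorial_card_fiber_fin, ← (e.arrowCongr (Equiv.refl (Fin n))).sum_comp]
    refine sum_congr rfl fun β _ => prod_congr rfl fun a _ => congrArg _ ?_
    exact card_equiv e (by simp)
  rw [h]
  generalize Fintype.card S = s
  have hj : ∀ j ≤ s, n.ascFactorial j ≤ (n + s) ^ j := by
    intro j
    induction j with
    | zero => simp
    | succ j ih =>
      intro hj
      rw [Nat.ascFactorial_succ, pow_succ']
      exact Nat.mul_le_mul (by omega) (ih (by omega))
  exact hj s le_rfl

/-- The labels in the fibre weights need not run over all labellings: the form in which the birth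
labels are summed. -/
theorem sum_finset_prod_factorial_card_fiber_le {S : Type*} [Fintype S] {n : ℕ}
    (B : Finset (S → Fin n)) :
    ∑ β ∈ B, ∏ a, (#{x | β x = a}).factorial ≤ (n + Fintype.card S) ^ Fintype.card S := by
  classical
  exact (sum_le_sum_of_subset (subset_univ B)).trans (sum_prod_factorial_card_fiber_le n)

/-- The permutations that keep `h ∘ ρ` are a coset of the stabilizer of a labelling. -/
theorem card_perm_comp_eq {α : Type*} [Fintype α] [DecidableEq α] {n : ℕ} (h : α → Fin n)
    (ρ₀ : Equiv.Perm α) :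
    #{ρ : Equiv.Perm α | h ∘ ρ = h ∘ ρ₀} = ∏ a, (#{x | h (ρ₀ x) = a}).factorial := by
  have key := DomMulAct.stabilizer_card (h ∘ ρ₀)
  have h1 : ∀ a, Fintype.card {x // (h ∘ ρ₀) x = a} = #{x | h (ρ₀ x) = a} := fun a => by
    rw [Fintype.card_subtype]; rfl
  simp only [h1] at key
  rw [← key, Fintype.card_subtype]
  refine card_equiv (Equiv.mulLeft ρ₀⁻¹) fun ρ => ?_
  simp only [mem_filter, mem_univ, true_and, Equiv.coe_mulLeft, Equiv.Perm.coe_mul,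
    Function.comp_assoc]
  rw [← Function.comp_assoc (⇑ρ₀)]
  have : (⇑ρ₀ ∘ ⇑ρ₀⁻¹) = id := by ext x; simp
  rw [this, Function.id_comp]

theorem factorial_le_mul_pow {B O T : ℕ} (hO : O ≤ T) :
    O.factorial ≤ B.factorial * T ^ (O - B) := by
  rcases le_total O B with h | h
  · rw [Nat.sub_eq_zero_of_le h, pow_zero, mul_one]
    exact Nat.factorial_le h
  · induction O, h using Nat.le_induction with
    | base => simp
    | succ k hk ih =>
      rw [Nat.factorial_succ, Nat.succ_sub hk, pow_succ, ← mul_assoc, mul_comm]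
      exact Nat.mul_le_mul (ih (by omega)) hO

/-! ### Words and the labels of their factors -/

/-- The factors of a word of length `L`: the step `t`, the tensor factor `j` of `N^{⊗d}`, and the
half of the Kronecker product. -/
abbrev Factor (L d : ℕ) : Type := Fin L × Fin d × Fin 2

section Labels

variable {κ d n L : ℕ}

/-- The labels that enter a factor: those of `V_t` at the positions to which `π_t` moves the
positions of the factor. -/
def inLab (π : Fin L → Equiv.Perm (Pos κ d)) (V : Fin (L + 1) → Pos κ d → Fin n)
    (f : Factor L d) : Fin κ → Fin n :=
  fun s => V f.1.castSucc (π f.1 (f.2.1, f.2.2, s))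

/-- The labels that leave a factor: those of `V_{t+1}` at the positions of the factor. -/
def outLab (V : Fin (L + 1) → Pos κ d → Fin n) (f : Factor L d) : Fin κ → Fin n :=
  fun s => V f.1.succ (f.2.1, f.2.2, s)

/-- The row label (`b = false`) and the column label (`b = true`) of the entry at a factor. At even
steps the matrix `N^{⊗d}` is used, and the labels that enter are row labels; at odd steps its
transpose is used, and they are column labels. -/
def lab (π : Fin L → Equiv.Perm (Pos κ d)) (V : Fin (L + 1) → Pos κ d → Fin n)
    (f : Factor L d) (b : Bool) : Fin κ → Fin n :=
  if b = f.1.val.bodd then inLab π V f else outLab V f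

/-- Every factor carries the same row and column labels as its representative. -/
def Consistent (rep : Factor L d → Factor L d) (π : Fin L → Equiv.Perm (Pos κ d))
    (V : Fin (L + 1) → Pos κ d → Fin n) : Prop :=
  ∀ f b, lab π V f b = lab π V (rep f) b

/-- The positions at step `t` that belong to an old factor, that is, to one which is not its own
representative. -/
abbrev OldPos (κ : ℕ) (rep : Factor L d → Factor L d) (t : Fin L) : Type :=
  {x : Pos κ d // rep (t, x.1, x.2.1) ≠ (t, x.1, x.2.1)}

/-- A permutation of the old positions at every step. -/
abbrev OldPerm (κ : ℕ) (rep : Factor L d → Factor L d) : Type :=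
  ∀ t : Fin L, Equiv.Perm (OldPos κ rep t)

/-- The permutations of all positions that fix the positions of the new factors. -/
def extend {rep : Factor L d → Factor L d} (τ : OldPerm κ rep) :
    Fin L → Equiv.Perm (Pos κ d) :=
  fun t => Equiv.Perm.ofSubtype (p := fun x : Pos κ d => rep (t, x.1, x.2.1) ≠ (t, x.1, x.2.1))
    (τ t)

/-- The places at which labels are born: the positions of `V_0`, and the places on the outgoing
side of the new factors. -/
abbrev NewSlot (κ : ℕ) (rep : Factor L d → Factor L d) : Type :=
  Pos κ d ⊕ ({f : Factor L d // rep f = f} × Fin κ)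

/-- The birth labels of a sequence of multi-indices. -/
def birth (rep : Factor L d → Factor L d) (V : Fin (L + 1) → Pos κ d → Fin n) :
    NewSlot κ rep → Fin n :=
  Sum.elim (V 0) fun p => outLab V p.1 p.2

theorem extend_of_new {rep : Factor L d → Factor L d} (τ : OldPerm κ rep) {f : Factor L d}
    (hf : rep f = f) (s : Fin κ) : extend τ f.1 (f.2.1, f.2.2, s) = (f.2.1, f.2.2, s) :=
  Equiv.Perm.ofSubtype_apply_of_not_mem _ (by simpa using hf)

theorem extend_of_old {rep : Factor L d → Factor L d} (τ : OldPerm κ rep) (t : Fin L)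
    (x : OldPos κ rep t) : extend τ t x.1 = (τ t x).1 :=
  Equiv.Perm.ofSubtype_apply_coe
    (p := fun x : Pos κ d => rep (t, x.1, x.2.1) ≠ (t, x.1, x.2.1)) _ _

theorem inLab_mul_extend_of_new {rep : Factor L d → Factor L d} (τ : OldPerm κ rep)
    (π : Fin L → Equiv.Perm (Pos κ d)) (V : Fin (L + 1) → Pos κ d → Fin n) {f : Factor L d}
    (hf : rep f = f) : inLab (π * extend τ) V f = inLab π V f := by
  ext1 s
  simp only [inLab, Pi.mul_apply, Equiv.Perm.mul_apply, extend_of_new τ hf]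

theorem lab_mul_extend_of_new {rep : Factor L d → Factor L d} (τ : OldPerm κ rep)
    (π : Fin L → Equiv.Perm (Pos κ d)) (V : Fin (L + 1) → Pos κ d → Fin n) {f : Factor L d}
    (hf : rep f = f) (b : Bool) : lab (π * extend τ) V f b = lab π V f b := by
  simp only [lab, inLab_mul_extend_of_new τ π V hf]

/-- A consistent sequence of multi-indices is determined by its birth labels, even if the old
positions are permuted. Step by step, the outgoing labels of an old factor are labels of its
representative: either labels entering a new factor at the same step or earlier, which depend
neither on `τ` nor on later multi-indices, or labels leaving a new factor. -/
theorem eq_of_birth_eq {rep : Factor L d → Factor L d} (hidem : ∀ f, rep (rep f) = rep f)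
    (hstep : ∀ f, (rep f).1 ≤ f.1) (π : Fin L → Equiv.Perm (Pos κ d)) {τ τ' : OldPerm κ rep}
    {V V' : Fin (L + 1) → Pos κ d → Fin n} (hV : Consistent rep (π * extend τ) V)
    (hV' : Consistent rep (π * extend τ') V') (hb : birth rep V = birth rep V') : V = V' := by
  have key : ∀ k : ℕ, ∀ t : Fin (L + 1), t.val = k → V t = V' t := by
    intro k
    induction k using Nat.strong_induction_on with
    | _ k ih =>
      intro t ht
      have hnew : ∀ f, rep f = f → outLab V f = outLab V' f := fun f hf => by
        ext1 s
        exact congrFun hb (Sum.inr (⟨f, hf⟩, s))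
      induction t using Fin.cases with
      | zero => ext1 x; exact congrFun hb (Sum.inl x)
      | succ t =>
        suffices h : ∀ j h, outLab V (t, j, h) = outLab V' (t, j, h) by
          ext1 ⟨j, h', s⟩
          exact congrFun (h j h') s
        intro j h
        have e := hV (t, j, h) (!t.val.bodd)
        have e' := hV' (t, j, h) (!t.val.bodd)
        rw [lab_mul_extend_of_new _ _ _ (hidem _)] at e e'
        have h1 : lab π V (rep (t, j, h)) (!t.val.bodd)
            = lab π V' (rep (t, j, h)) (!t.val.bodd) := by
          unfold lab
          split_ifs
          · ext1 s
            have hle : (rep (t, j, h)).1.val ≤ t.val := hstep (t, j, h)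
            simp only [inLab]
            rw [ih (rep (t, j, h)).1.val (by simp at ht; omega)
              (rep (t, j, h)).1.castSucc (by simp)]
          · exact hnew _ (hidem _)
        have h2 := e.trans (h1.trans e'.symm)
        simpa [lab] using h2
  ext1 t
  exact key t t rfl

end Labels

/-! ### The balance of labels -/

section Balance

variable {κ d n L : ℕ}

/-- Conservation of labels: what leaves the factors of one step enters those of the next. -/
theorem sum_inLab_add (π : Fin L → Equiv.Perm (Pos κ d)) (V : Fin (L + 1) → Pos κ d → Fin n)
    (a : Fin n) :
    ∑ f, #{s | inLab π V f s = a} + #{x | V (Fin.last L) x = a}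
      = #{x | V 0 x = a} + ∑ f, #{s | outLab V f s = a} := by
  have h1 : ∑ f, #{s | inLab π V f s = a} = ∑ t : Fin L, #{x | V t.castSucc x = a} := by
    simp only [card_filter]
    rw [Fintype.sum_prod_type]
    refine sum_congr rfl fun t _ => ?_
    rw [← Equiv.sum_comp (π t) fun x => if V t.castSucc x = a then 1 else 0]
    simp only [Fintype.sum_prod_type, inLab]
    rfl
  have h2 : ∑ f, #{s | outLab V f s = a} = ∑ t : Fin L, #{x | V t.succ x = a} := by
    simp only [card_filter]
    rw [Fintype.sum_prod_type]
    refine sum_congr rfl fun t _ => ?_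
    simp only [Fintype.sum_prod_type, outLab]
    rfl
  rw [h1, h2, ← Fin.sum_univ_castSucc fun t : Fin (L + 1) => #{x | V t x = a},
    Fin.sum_univ_succ]

theorem card_inLab_add_card_outLab (π : Fin L → Equiv.Perm (Pos κ d))
    (V : Fin (L + 1) → Pos κ d → Fin n) (f : Factor L d) (a : Fin n) :
    #{s | inLab π V f s = a} + #{s | outLab V f s = a}
      = #{s | lab π V f false s = a} + #{s | lab π V f true s = a} := by
  unfold lab
  cases f.1.val.bodd <;> simp [add_comm]

/-- The balance inequality `2 O_a ≤ 2 B_a + ex_a` between the number of times a label enters an old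
factor and the number of times it is born. By consistency the total number of occurrences of a
label on both sides of all factors is a sum over the new factors, each counted with the number of
factors it represents. -/
theorem two_mul_sum_old_le {rep : Factor L d → Factor L d} (hidem : ∀ f, rep (rep f) = rep f)
    (hfib : ∀ f, rep f = f → 2 ≤ #{g | rep g = f}) {π : Fin L → Equiv.Perm (Pos κ d)}
    {V : Fin (L + 1) → Pos κ d → Fin n} (hV : Consistent rep π V) (a : Fin n) :
    2 * ∑ f with rep f ≠ f, #{s | inLab π V f s = a}
      ≤ 2 * (#{x | V 0 x = a} + ∑ f with rep f = f, #{s | outLab V f s = a})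
        + ∑ f with rep f = f, (#{g | rep g = f} - 2)
            * (#{s | inLab π V f s = a} + #{s | outLab V f s = a}) := by
  have hbal := sum_inLab_add π V a
  have htot : ∑ f, (#{s | inLab π V f s = a} + #{s | outLab V f s = a})
      = ∑ f with rep f = f, #{g | rep g = f}
          * (#{s | inLab π V f s = a} + #{s | outLab V f s = a}) := by
    rw [← sum_fiberwise_of_maps_to (s := univ) (t := univ.filter fun f => rep f = f) (g := rep)
      (by simp [hidem])]
    refine sum_congr rfl fun f _ => ?_
    rw [← smul_eq_mul, ← sum_const]
    refine sum_congr rfl fun g hg => ?_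
    rw [card_inLab_add_card_outLab, card_inLab_add_card_outLab, hV g, hV g, (mem_filter.1 hg).2]
  have hsplit : ∑ f with rep f = f, #{g | rep g = f}
          * (#{s | inLab π V f s = a} + #{s | outLab V f s = a})
      = ∑ f with rep f = f, (#{g | rep g = f} - 2)
          * (#{s | inLab π V f s = a} + #{s | outLab V f s = a})
        + 2 * ∑ f with rep f = f, (#{s | inLab π V f s = a} + #{s | outLab V f s = a}) := by
    rw [mul_sum, ← sum_add_distrib]
    refine sum_congr rfl fun f hf => ?_
    rw [← add_mul, Nat.sub_add_cancel (hfib f (mem_filter.1 hf).2)]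
  have h1 := sum_filter_add_sum_filter_not univ (fun f => rep f = f)
    fun f => #{s | inLab π V f s = a}
  have h2 := sum_filter_add_sum_filter_not univ (fun f => rep f = f)
    fun f => #{s | outLab V f s = a}
  simp only [sum_add_distrib] at htot hsplit
  simp only [← ne_eq] at h1 h2
  omega

/-- The excess in the balance inequality, summed over all labels: every factor beyond the second
with the same entry contributes its `2κ` labels. -/
theorem sum_excess {rep : Factor L d → Factor L d} (hidem : ∀ f, rep (rep f) = rep f)
    (hfib : ∀ f, rep f = f → 2 ≤ #{g | rep g = f}) (π : Fin L → Equiv.Perm (Pos κ d))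
    (V : Fin (L + 1) → Pos κ d → Fin n) :
    ∑ a, ∑ f with rep f = f, (#{g | rep g = f} - 2)
        * (#{s | inLab π V f s = a} + #{s | outLab V f s = a})
      = 2 * (κ * (Fintype.card (Factor L d) - 2 * #{f | rep f = f})) := by
  have hk : ∀ u : Fin κ → Fin n, ∑ a, #{s | u s = a} = κ := fun u => by
    rw [← card_eq_sum_card_fiberwise (by simp)]; simp
  rw [sum_comm]
  simp only [← mul_sum, sum_add_distrib, hk, ← sum_mul]
  have hE : ∑ f with rep f = f, #{g | rep g = f} = Fintype.card (Factor L d) := by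
    rw [← card_eq_sum_card_fiberwise (by simp [hidem])]
    simp
  have h2 : ∑ f with rep f = f, (#{g | rep g = f} - 2) + 2 * #{f | rep f = f}
      = Fintype.card (Factor L d) := by
    rw [← hE, mul_comm, ← smul_eq_mul, ← sum_const, ← sum_add_distrib]
    exact sum_congr rfl fun f hf => Nat.sub_add_cancel (hfib f (mem_filter.1 hf).2)
  rw [show ∑ f with rep f = f, (#{g | rep g = f} - 2)
    = Fintype.card (Factor L d) - 2 * #{f | rep f = f} by omega]
  ring

theorem card_birth_eq (rep : Factor L d → Factor L d) (V : Fin (L + 1) → Pos κ d → Fin n)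
    (a : Fin n) : #{x | birth rep V x = a}
      = #{x | V 0 x = a} + ∑ f with rep f = f, #{s | outLab V f s = a} := by
  simp only [card_filter]
  rw [Fintype.sum_sum_type]
  refine congrArg _ ?_
  rw [Fintype.sum_prod_type]
  exact (sum_subtype (univ.filter fun f => rep f = f) (by simp)
    fun f => ∑ s, if outLab V f s = a then 1 else 0).symm

theorem sum_card_old_eq {rep : Factor L d → Factor L d} (τ : OldPerm κ rep)
    (π : Fin L → Equiv.Perm (Pos κ d)) (V : Fin (L + 1) → Pos κ d → Fin n) (a : Fin n) :
    ∑ t, #{x : OldPos κ rep t | V t.castSucc (π t (τ t x).1) = a}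
      = ∑ f with rep f ≠ f, #{s | inLab (π * extend τ) V f s = a} := by
  rw [sum_filter, Fintype.sum_prod_type]
  refine sum_congr rfl fun t _ => ?_
  simp only [card_filter]
  have h1 : ∀ x : OldPos κ rep t, (if V t.castSucc (π t (τ t x).1) = a then 1 else 0)
      = if V t.castSucc (π t (extend τ t x.1)) = a then 1 else 0 := fun x => by
    rw [extend_of_old]
  rw [sum_congr rfl fun x _ => h1 x]
  refine (sum_subtype
    (univ.filter fun x : Pos κ d => rep (t, x.1, x.2.1) ≠ (t, x.1, x.2.1)) (by simp)
    fun x => if V t.castSucc (π t (extend τ t x)) = a then 1 else 0).symm.trans ?_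
  rw [sum_filter]
  simp only [Fintype.sum_prod_type]
  refine sum_congr rfl fun j _ => sum_congr rfl fun h _ => ?_
  split_ifs
  · exact sum_congr rfl fun s _ => rfl
  · exact sum_const_zero

/-- For fixed multi-indices, the permutations of the old positions that are consistent with them
are at most `∏ a, O_a!` many, and hence at most `∏ a, B_a!` up to the excess. -/
theorem card_consistent_perm_le {rep : Factor L d → Factor L d}
    (hidem : ∀ f, rep (rep f) = rep f) (hfib : ∀ f, rep f = f → 2 ≤ #{g | rep g = f})
    (π : Fin L → Equiv.Perm (Pos κ d)) {V : Fin (L + 1) → Pos κ d → Fin n} {τ₀ : OldPerm κ rep}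
    (hV : Consistent rep (π * extend τ₀) V) {T : ℕ} (hT1 : 1 ≤ T)
    (hT : κ * Fintype.card (Factor L d) ≤ T) :
    Nat.card {τ : OldPerm κ rep // Consistent rep (π * extend τ) V}
      ≤ (∏ a, (#{x | birth rep V x = a}).factorial)
        * T ^ (κ * (Fintype.card (Factor L d) - 2 * #{f | rep f = f})) := by
  classical
  set O : Fin n → ℕ := fun a => ∑ f with rep f ≠ f, #{s | inLab (π * extend τ₀) V f s = a} with hO
  set B : Fin n → ℕ := fun a => #{x | birth rep V x = a} with hB
  have hbal : ∀ a, 2 * O a ≤ 2 * B a + ∑ f with rep f = f, (#{g | rep g = f} - 2)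
        * (#{s | inLab (π * extend τ₀) V f s = a} + #{s | outLab V f s = a}) := fun a => by
    simp only [hO, hB, card_birth_eq]
    exact two_mul_sum_old_le hidem hfib hV a
  have hOT : ∀ a, O a ≤ T := fun a => by
    refine le_trans ?_ hT
    calc O a ≤ ∑ f : Factor L d, #{s | inLab (π * extend τ₀) V f s = a} :=
          sum_le_sum_of_subset (filter_subset _ _)
      _ ≤ ∑ f : Factor L d, κ := sum_le_sum fun f _ => (card_le_univ _).trans (by simp)
      _ = _ := by simp [mul_comm]
  have hexp : ∑ a, (O a - B a) ≤ κ * (Fintype.card (Factor L d) - 2 * #{f | rep f = f}) := by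
    have h := sum_excess hidem hfib (π * extend τ₀) V
    have h2 : 2 * ∑ a, (O a - B a)
        ≤ 2 * (κ * (Fintype.card (Factor L d) - 2 * #{f | rep f = f})) := by
      rw [← h, mul_sum]
      refine sum_le_sum fun a _ => ?_
      have := hbal a
      omega
    omega
  have hsub : Nat.card {τ : OldPerm κ rep // Consistent rep (π * extend τ) V}
      ≤ ∏ t, #{ρ : Equiv.Perm (OldPos κ rep t) |
          (fun x : OldPos κ rep t => V t.castSucc (π t x.1)) ∘ ρ
            = (fun x : OldPos κ rep t => V t.castSucc (π t x.1)) ∘ τ₀ t} := by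
    rw [← Fintype.card_piFinset, Nat.card_eq_fintype_card, Fintype.card_subtype]
    refine card_le_card fun τ hτ => ?_
    have hτ' : Consistent rep (π * extend τ) V := (mem_filter.1 hτ).2
    rw [Fintype.mem_piFinset]
    intro t
    rw [mem_filter]
    refine ⟨mem_univ _, ?_⟩
    ext1 x
    -- both sides are the label prescribed by the representative of the factor at this position
    have e1 := hτ' (t, x.1.1, x.1.2.1) t.val.bodd
    have e2 := hV (t, x.1.1, x.1.2.1) t.val.bodd
    rw [lab_mul_extend_of_new _ _ _ (hidem _)] at e1 e2
    have e3 := congrFun (e1.trans e2.symm) x.1.2.2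
    simp only [lab, if_true, inLab, Pi.mul_apply, Equiv.Perm.mul_apply] at e3
    have := extend_of_old τ t x
    have := extend_of_old τ₀ t x
    simp_all
  calc _ ≤ _ := hsub
    _ = ∏ t, ∏ a, (#{x : OldPos κ rep t | V t.castSucc (π t (τ₀ t x).1) = a}).factorial :=
        prod_congr rfl fun t _ =>
          card_perm_comp_eq (fun x : OldPos κ rep t => V t.castSucc (π t x.1)) (τ₀ t)
    _ = ∏ a, ∏ t, (#{x : OldPos κ rep t | V t.castSucc (π t (τ₀ t x).1) = a}).factorial :=
        prod_comm
    _ ≤ ∏ a, (O a).factorial := by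
        refine prod_le_prod' fun a _ => ?_
        rw [show O a = _ from (sum_card_old_eq τ₀ π V a).symm]
        exact Nat.le_of_dvd (Nat.factorial_pos _) (Nat.prod_factorial_dvd_factorial_sum _ _)
    _ ≤ ∏ a, ((B a).factorial * T ^ (O a - B a)) :=
        prod_le_prod' fun a _ => factorial_le_mul_pow (hOT a)
    _ = (∏ a, (B a).factorial) * T ^ ∑ a, (O a - B a) := by
        rw [prod_mul_distrib, prod_pow_eq_pow_sum]
    _ ≤ _ := Nat.mul_le_mul_left _ (Nat.pow_le_pow_right hT1 hexp)

end Balance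

/-! ### Counting consistent words -/

section Count

variable {κ d n L : ℕ}

open Classical in
/-- For fixed `π`, the sum over the sequences of multi-indices becomes a sum over birth labels. -/
theorem sum_perm_consistent_le {rep : Factor L d → Factor L d}
    (hidem : ∀ f, rep (rep f) = rep f) (hstep : ∀ f, (rep f).1 ≤ f.1)
    (hfib : ∀ f, rep f = f → 2 ≤ #{g | rep g = f}) (π : Fin L → Equiv.Perm (Pos κ d))
    {T : ℕ} (hT1 : 1 ≤ T) (hT : κ * Fintype.card (Factor L d) ≤ T) :
    ∑ τ : OldPerm κ rep, ∑ V : Fin (L + 1) → Pos κ d → Fin n,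
        (if Consistent rep (π * extend τ) V then 1 else 0)
      ≤ T ^ (κ * (Fintype.card (Factor L d) - 2 * #{f | rep f = f}))
        * (n + Fintype.card (NewSlot κ rep)) ^ Fintype.card (NewSlot κ rep) := by
  generalize hX : κ * (Fintype.card (Factor L d) - 2 * #{f | rep f = f}) = X
  set G : Finset (Fin (L + 1) → Pos κ d → Fin n) :=
    {V | ∃ τ : OldPerm κ rep, Consistent rep (π * extend τ) V} with hG
  have h1 : ∀ V : Fin (L + 1) → Pos κ d → Fin n,
      ∑ τ : OldPerm κ rep, (if Consistent rep (π * extend τ) V then 1 else 0)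
        = Nat.card {τ : OldPerm κ rep // Consistent rep (π * extend τ) V} := fun V => by
    rw [Nat.card_eq_fintype_card, Fintype.card_subtype, card_filter]
  rw [sum_comm]
  calc _ = ∑ V : Fin (L + 1) → Pos κ d → Fin n,
          Nat.card {τ : OldPerm κ rep // Consistent rep (π * extend τ) V} :=
        sum_congr rfl fun V _ => h1 V
    _ = ∑ V ∈ G, Nat.card {τ : OldPerm κ rep // Consistent rep (π * extend τ) V} := by
        refine (sum_subset (subset_univ G) fun V _ hV => ?_).symm
        have : IsEmpty {τ : OldPerm κ rep // Consistent rep (π * extend τ) V} :=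
          ⟨fun τ => hV (by simpa [hG] using ⟨τ.1, τ.2⟩)⟩
        exact Nat.card_of_isEmpty
    _ ≤ ∑ V ∈ G, (∏ a, (#{x | birth rep V x = a}).factorial) * T ^ X := by
        refine sum_le_sum fun V hV => ?_
        obtain ⟨τ, hτ⟩ := (mem_filter.1 hV).2
        rw [← hX]
        exact card_consistent_perm_le hidem hfib π hτ hT1 hT
    _ = (∑ V ∈ G, ∏ a, (#{x | birth rep V x = a}).factorial) * T ^ X := (sum_mul ..).symm
    _ = (∑ β ∈ G.image (birth rep), ∏ a, (#{x | β x = a}).factorial) * T ^ X := by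
        rw [sum_image]
        intro V hV V' hV' h
        obtain ⟨τ, hτ⟩ := (mem_filter.1 hV).2
        obtain ⟨τ', hτ'⟩ := (mem_filter.1 hV').2
        exact eq_of_birth_eq hidem hstep π hτ hτ' h
    _ ≤ (n + Fintype.card (NewSlot κ rep)) ^ Fintype.card (NewSlot κ rep) * T ^ X :=
        Nat.mul_le_mul_right (T ^ X) (sum_finset_prod_factorial_card_fiber_le _)
    _ = _ := mul_comm _ _

open Classical in
/-- Averaging over the permutations of the positions that carry repeated factors. -/
theorem sum_consistent_mul_le {rep : Factor L d → Factor L d}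
    (hidem : ∀ f, rep (rep f) = rep f) (hstep : ∀ f, (rep f).1 ≤ f.1)
    (hfib : ∀ f, rep f = f → 2 ≤ #{g | rep g = f})
    {T : ℕ} (hT1 : 1 ≤ T) (hT : κ * Fintype.card (Factor L d) ≤ T) :
    (∑ π : Fin L → Equiv.Perm (Pos κ d), ∑ V : Fin (L + 1) → Pos κ d → Fin n,
        (if Consistent rep π V then 1 else 0)) * ∏ t, (Fintype.card (OldPos κ rep t)).factorial
      ≤ (Fintype.card (Equiv.Perm (Pos κ d))) ^ L
        * (T ^ (κ * (Fintype.card (Factor L d) - 2 * #{f | rep f = f}))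
          * (n + Fintype.card (NewSlot κ rep)) ^ Fintype.card (NewSlot κ rep)) := by
  have hc : ∏ t, (Fintype.card (OldPos κ rep t)).factorial = Fintype.card (OldPerm κ rep) := by
    rw [Fintype.card_pi]
    exact prod_congr rfl fun t _ => Fintype.card_perm.symm
  have hc' : (Fintype.card (Equiv.Perm (Pos κ d))) ^ L
      = Fintype.card (Fin L → Equiv.Perm (Pos κ d)) := by
    rw [Fintype.card_fun, Fintype.card_fin]
  rw [hc, hc', mul_comm, ← smul_eq_mul, ← card_univ, ← sum_const]
  calc _ = ∑ τ : OldPerm κ rep, ∑ π : Fin L → Equiv.Perm (Pos κ d),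
          ∑ V : Fin (L + 1) → Pos κ d → Fin n,
            (if Consistent rep (π * extend τ) V then 1 else 0) :=
        sum_congr rfl fun τ _ => (Equiv.sum_comp (Equiv.mulRight (extend τ)) fun π =>
          ∑ V : Fin (L + 1) → Pos κ d → Fin n, (if Consistent rep π V then 1 else 0)).symm
    _ = ∑ π : Fin L → Equiv.Perm (Pos κ d), ∑ τ : OldPerm κ rep,
          ∑ V : Fin (L + 1) → Pos κ d → Fin n,
            (if Consistent rep (π * extend τ) V then 1 else 0) := sum_comm
    _ ≤ ∑ π : Fin L → Equiv.Perm (Pos κ d), _ :=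
        sum_le_sum fun π _ => sum_perm_consistent_le hidem hstep hfib π hT1 hT
    _ = _ := by rw [sum_const, smul_eq_mul, card_univ]

theorem card_factor : Fintype.card (Factor L d) = 2 * (L * d) := by
  simp [Factor]; ring

theorem card_newSlot (rep : Factor L d → Factor L d) :
    Fintype.card (NewSlot κ rep) = 2 * κ * d + κ * #{f | rep f = f} := by
  simp only [NewSlot, Fintype.card_sum, Fintype.card_prod, Fintype.card_fin, Fintype.card_subtype]
  ring

theorem sum_card_oldPos (rep : Factor L d → Factor L d) :
    ∑ t, Fintype.card (OldPos κ rep t) + κ * #{f | rep f = f} = κ * (2 * (L * d)) := by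
  have h1 : ∑ t, Fintype.card (OldPos κ rep t) = κ * #{f | rep f ≠ f} := by
    simp only [Fintype.card_subtype, card_filter]
    rw [Fintype.sum_prod_type, mul_sum]
    refine sum_congr rfl fun t _ => ?_
    simp only [Fintype.sum_prod_type, mul_sum]
    refine sum_congr rfl fun j _ => sum_congr rfl fun h _ => ?_
    split_ifs <;> simp
  rw [h1, ← mul_add, add_comm, ← card_factor, ← card_univ,
    ← card_filter_add_card_filter_not (s := univ) fun f : Factor L d => rep f = f]

/-- At most half of the factors are new, since every new factor represents at least two. -/
theorem card_new_le {rep : Factor L d → Factor L d} (hidem : ∀ f, rep (rep f) = rep f)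
    (hfib : ∀ f, rep f = f → 2 ≤ #{g | rep g = f}) : #{f | rep f = f} ≤ L * d := by
  have hE : ∑ f with rep f = f, #{g | rep g = f} = Fintype.card (Factor L d) := by
    rw [← card_eq_sum_card_fiberwise (by simp [hidem])]
    simp
  have h2 : #{f | rep f = f} * 2 ≤ ∑ f with rep f = f, #{g | rep g = f} := by
    rw [← smul_eq_mul, ← sum_const]
    exact sum_le_sum fun f hf => hfib f (mem_filter.1 hf).2
  rw [hE, card_factor] at h2
  omega

end Count

/-! ### The sum over the slice indices -/

section Slices

variable {ι : Type*} [Fintype ι] {n : ℕ}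

/-- The weight of a class of `s ≥ 2` equal slice indices. For `s = 2` it is a constant; for `s ≥ 3`
the deficit `6 s - 12` in the exponent absorbs the factor `s ^ (2 s)`. -/
theorem fiber_weight_le {s P : ℕ} (hs : 2 ≤ s) (hsP : s ≤ P) :
    ((2 * s) ^ 2) ^ s * P ^ 12 ≤ 16 ^ s * P ^ (6 * s) := by
  rcases hs.eq_or_lt with rfl | hs3
  · norm_num
  · calc ((2 * s) ^ 2) ^ s * P ^ 12 = 4 ^ s * s ^ (2 * s) * P ^ 12 := by
          rw [show (2 * s) ^ 2 = 4 * s ^ 2 by ring, mul_pow, ← pow_mul]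
      _ ≤ 16 ^ s * P ^ (2 * s) * P ^ 12 := by gcongr; norm_num
      _ = 16 ^ s * P ^ (2 * s + 12) := by rw [mul_assoc, pow_add]
      _ ≤ 16 ^ s * P ^ (6 * s) := by
          refine Nat.mul_le_mul_left _ (Nat.pow_le_pow_right (by omega) (by omega))

theorem prod_fiber_weight_le {i : ι → Fin n} (hi : ∀ p, 2 ≤ #{p' | i p' = i p}) :
    (∏ p, (2 * #{p' | i p' = i p}) ^ 2) * (Fintype.card ι ^ 12) ^ #(univ.image i)
      ≤ 16 ^ Fintype.card ι * Fintype.card ι ^ (6 * Fintype.card ι) := by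
  set P := Fintype.card ι with hP
  have h1 : ∏ p, (2 * #{p' | i p' = i p}) ^ 2
      = ∏ a ∈ univ.image i, ((2 * #{p' | i p' = a}) ^ 2) ^ #{p' | i p' = a} := by
    rw [prod_comp (fun a => (2 * #{p' | i p' = a}) ^ 2) i]
  have h2 : ∑ a ∈ univ.image i, #{p' | i p' = a} = P := by
    rw [← card_eq_sum_card_image, card_univ]
  rw [h1, ← prod_const, ← prod_mul_distrib]
  calc _ ≤ ∏ a ∈ univ.image i, 16 ^ #{p' | i p' = a} * P ^ (6 * #{p' | i p' = a}) := by
        refine prod_le_prod' fun a ha => ?_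
        obtain ⟨p, -, rfl⟩ := mem_image.1 ha
        exact fiber_weight_le (hi p) (card_le_univ _)
    _ = _ := by rw [prod_mul_distrib, prod_pow_eq_pow_sum, prod_pow_eq_pow_sum, ← mul_sum, h2]

theorem two_mul_card_image_le {i : ι → Fin n} (hi : ∀ p, 2 ≤ #{p' | i p' = i p}) :
    2 * #(univ.image i) ≤ Fintype.card ι := by
  rw [← card_univ, card_eq_sum_card_image i univ, mul_comm, ← smul_eq_mul, ← sum_const]
  refine sum_le_sum fun a ha => ?_
  obtain ⟨p, -, rfl⟩ := mem_image.1 ha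
  exact hi p

theorem choose_mul_pow_le {n q P : ℕ} (hq : q ≤ P) :
    (n.choose q : ℝ) * (q : ℝ) ^ P ≤ Real.exp 1 ^ P * ((n : ℝ) ^ q * (P : ℝ) ^ (P - q)) := by
  have h1 : (n.choose q : ℝ) ≤ (n : ℝ) ^ q / q.factorial := Nat.choose_le_pow_div q n
  have h2 : (q : ℝ) ^ q / q.factorial ≤ Real.exp 1 ^ q := by
    rw [← Real.exp_nat_mul, mul_one]
    exact Real.pow_div_factorial_le_exp _ (Nat.cast_nonneg q) q
  have h3 : Real.exp 1 ^ q ≤ Real.exp 1 ^ P := pow_le_pow_right₀ (Real.one_le_exp zero_le_one) hq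
  have h4 : (q : ℝ) ^ (P - q) ≤ (P : ℝ) ^ (P - q) := by gcongr
  calc (n.choose q : ℝ) * (q : ℝ) ^ P
      ≤ (n : ℝ) ^ q / q.factorial * ((q : ℝ) ^ q * (q : ℝ) ^ (P - q)) := by
        rw [← pow_add, Nat.add_sub_cancel' hq]; gcongr
    _ = (q : ℝ) ^ q / q.factorial * ((n : ℝ) ^ q * (q : ℝ) ^ (P - q)) := by ring
    _ ≤ Real.exp 1 ^ P * ((n : ℝ) ^ q * (P : ℝ) ^ (P - q)) := by
        gcongr; exact h2.trans h3

/-- The sum over the slice indices. A pattern in which all classes have size two contributes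
`(n P) ^ (P / 2)`; the classes of size at least three are negligible since `P ^ 13 ≤ n`. -/
theorem sum_slice_weight_le [DecidableEq ι] {Q : ℕ} (hQ : Fintype.card ι = 2 * Q) (hQ0 : 1 ≤ Q)
    (hn : (2 * Q) ^ 13 ≤ n) :
    ∑ i : ι → Fin n with (∀ p, 2 ≤ #{p' | i p' = i p}), ∏ p, ((2 * #{p' | i p' = i p} : ℕ) : ℝ) ^ 2
      ≤ (32 * Real.exp 1) ^ (2 * Q) * ((n : ℝ) * (2 * Q)) ^ Q := by
  set P := 2 * Q with hP
  have hP0 : (0 : ℝ) < (P : ℝ) := by rw [hP]; push_cast; positivity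
  set g : Finset (Fin n) → ℝ := fun A => 16 ^ P * (P : ℝ) ^ (6 * P) / ((P : ℝ) ^ 12) ^ #A with hg
  have hg0 : ∀ A, 0 ≤ g A := fun A => by simp only [hg]; positivity
  have hweight : ∀ i : ι → Fin n, (∀ p, 2 ≤ #{p' | i p' = i p}) →
      ∏ p, ((2 * #{p' | i p' = i p} : ℕ) : ℝ) ^ 2 ≤ g (univ.image i) := fun i hi => by
    rw [hg, le_div_iff₀ (by positivity)]
    have := prod_fiber_weight_le hi
    rw [hQ] at this
    exact_mod_cast this
  have hcount : ∀ A : Finset (Fin n), #{i : ι → Fin n | univ.image i = A} ≤ #A ^ P := fun A => by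
    calc #{i : ι → Fin n | univ.image i = A} ≤ #(Fintype.piFinset fun _ : ι => A) := by
          refine card_le_card fun i hi => ?_
          rw [Fintype.mem_piFinset]
          intro p
          rw [← (mem_filter.1 hi).2]
          exact mem_image_of_mem i (mem_univ p)
      _ = #A ^ P := by rw [Fintype.card_piFinset, prod_const, card_univ, hQ]
  have hterm : ∀ q ∈ range (Q + 1), (n.choose q : ℝ) * ((q : ℝ) ^ P *
      (16 ^ P * (P : ℝ) ^ (6 * P) / ((P : ℝ) ^ 12) ^ q))
      ≤ (16 * Real.exp 1) ^ P * ((n : ℝ) * P) ^ Q := fun q hq => by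
    have hq' : q ≤ Q := Nat.lt_succ_iff.1 (mem_range.1 hq)
    obtain ⟨r, rfl⟩ := Nat.exists_eq_add_of_le hq'
    have h1 := choose_mul_pow_le (n := n) (q := q) (P := P) (by omega)
    have hn' : (P : ℝ) ^ 13 ≤ n := by exact_mod_cast hn
    rw [← mul_assoc, ← mul_div_assoc, div_le_iff₀ (by positivity)]
    calc (n.choose q : ℝ) * (q : ℝ) ^ P * (16 ^ P * (P : ℝ) ^ (6 * P))
        ≤ Real.exp 1 ^ P * ((n : ℝ) ^ q * (P : ℝ) ^ (P - q)) * (16 ^ P * (P : ℝ) ^ (6 * P)) := by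
          gcongr
      _ = (16 * Real.exp 1) ^ P * (n : ℝ) ^ q * ((P : ℝ) ^ (P - q) * (P : ℝ) ^ (6 * P)) := by
          rw [mul_pow]; ring
      _ = (16 * Real.exp 1) ^ P * (n : ℝ) ^ q *
            (((P : ℝ) ^ 13) ^ r * (P : ℝ) ^ (q + r) * ((P : ℝ) ^ 12) ^ q) := by
          rw [← pow_add, ← pow_mul, ← pow_mul, ← pow_add, ← pow_add]
          congr 2
          omega
      _ ≤ (16 * Real.exp 1) ^ P * (n : ℝ) ^ q *
            ((n : ℝ) ^ r * (P : ℝ) ^ (q + r) * ((P : ℝ) ^ 12) ^ q) := by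
          gcongr
      _ = (16 * Real.exp 1) ^ P * ((n : ℝ) * P) ^ (q + r) * ((P : ℝ) ^ 12) ^ q := by
          rw [mul_pow (n : ℝ), pow_add (n : ℝ)]; ring
  calc _ ≤ ∑ i : ι → Fin n with (∀ p, 2 ≤ #{p' | i p' = i p}), g (univ.image i) :=
        sum_le_sum fun i hi => hweight i (mem_filter.1 hi).2
    _ ≤ ∑ i : ι → Fin n with 2 * #(univ.image i) ≤ P, g (univ.image i) := by
        refine sum_le_sum_of_subset_of_nonneg (fun i hi => ?_) fun i _ _ => hg0 _
        simp only [mem_filter, mem_univ, true_and] at hi ⊢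
        exact hQ ▸ two_mul_card_image_le hi
    _ = ∑ A : Finset (Fin n) with #A ≤ Q, ∑ i : ι → Fin n with univ.image i = A, g A := by
        rw [← sum_fiberwise_of_maps_to (t := univ.filter fun A : Finset (Fin n) => #A ≤ Q)
          (g := fun i : ι → Fin n => univ.image i) (fun i hi => by simp_all)]
        refine sum_congr rfl fun A hA => ?_
        rw [filter_filter]
        refine sum_congr ?_ fun i hi => by rw [(mem_filter.1 hi).2]
        ext i
        simp only [mem_filter, mem_univ, true_and] at hA ⊢
        constructor
        · exact fun h => h.2
        · rintro rfl
          exact ⟨by omega, rfl⟩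
    _ ≤ ∑ A : Finset (Fin n) with #A ≤ Q, ((#A : ℝ) ^ P * g A) := by
        refine sum_le_sum fun A _ => ?_
        rw [sum_const, nsmul_eq_mul]
        exact mul_le_mul_of_nonneg_right (by exact_mod_cast hcount A) (hg0 A)
    _ = ∑ q ∈ range (Q + 1), ∑ A : Finset (Fin n) with #A = q, ((#A : ℝ) ^ P * g A) := by
        rw [← sum_fiberwise_of_maps_to (s := univ.filter fun A : Finset (Fin n) => #A ≤ Q)
          (t := range (Q + 1)) (g := fun A => #A) (fun A hA => by
            have := (mem_filter.1 hA).2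
            exact mem_range.2 (Nat.lt_succ_of_le this))]
        refine sum_congr rfl fun q hq => ?_
        rw [filter_filter]
        refine sum_congr ?_ fun _ _ => rfl
        ext A
        have := mem_range.1 hq
        simp only [mem_filter, mem_univ, true_and]
        omega
    _ = ∑ q ∈ range (Q + 1), (n.choose q : ℝ) * ((q : ℝ) ^ P *
          (16 ^ P * (P : ℝ) ^ (6 * P) / ((P : ℝ) ^ 12) ^ q)) := by
        refine sum_congr rfl fun q _ => ?_
        have hc : #{A : Finset (Fin n) | #A = q} = n.choose q := by
          rw [univ_filter_card_eq, card_powersetCard, card_univ, Fintype.card_fin]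
        rw [← hc, ← nsmul_eq_mul, ← sum_const]
        refine sum_congr rfl fun A hA => ?_
        simp only [hg, (mem_filter.1 hA).2]
    _ ≤ ∑ q ∈ range (Q + 1), (16 * Real.exp 1) ^ P * ((n : ℝ) * P) ^ Q := sum_le_sum hterm
    _ = (Q + 1 : ℕ) * ((16 * Real.exp 1) ^ P * ((n : ℝ) * P) ^ Q) := by
        rw [sum_const, card_range, nsmul_eq_mul]
    _ ≤ 2 ^ P * ((16 * Real.exp 1) ^ P * ((n : ℝ) * P) ^ Q) := by
        gcongr
        have : Q + 1 ≤ 2 ^ P := Nat.lt_two_pow_self.trans_le (Nat.pow_le_pow_right (by norm_num)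
          (by omega))
        exact_mod_cast this
    _ = _ := by
        rw [← mul_assoc, ← mul_pow, hP]; push_cast; ring

end Slices

/-- A lower bound on a product of factorials in terms of the sum of the arguments. -/
theorem pow_le_prod_factorial {τ : Type*} [Fintype τ] (s : τ → ℕ) {y : ℝ} (hy : 1 ≤ y) {N : ℕ}
    (hN : N ≤ ∑ t, s t) :
    y ^ N ≤ Real.exp (Fintype.card τ * y) * ∏ t, ((s t).factorial : ℝ) := by
  have h1 : ∀ t, y ^ s t ≤ Real.exp y * ((s t).factorial : ℝ) := fun t => by
    have := Real.pow_div_factorial_le_exp y (by linarith) (s t)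
    rwa [div_le_iff₀ (by positivity)] at this
  calc y ^ N ≤ y ^ ∑ t, s t := pow_le_pow_right₀ hy hN
    _ = ∏ t, y ^ s t := (prod_pow_eq_pow_sum ..).symm
    _ ≤ ∏ t, (Real.exp y * ((s t).factorial : ℝ)) :=
        prod_le_prod (fun t _ => by positivity) fun t _ => h1 t
    _ = _ := by rw [prod_mul_distrib, prod_const, ← Real.exp_nat_mul, card_univ]

/-! ### Representatives of repeated entries -/

/-- The index of an entry of the tensor: slice, row and column. -/
abbrev Entry (κ n : ℕ) : Type := Fin n × (Fin κ → Fin n) × (Fin κ → Fin n)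

section Words

variable {κ d n L : ℕ}

/-- The entry at each factor, for given permutations, multi-indices and slice indices. -/
def word (π : Fin L → Equiv.Perm (Pos κ d)) (V : Fin (L + 1) → Pos κ d → Fin n)
    (i : Fin L × Fin d → Fin n) (f : Factor L d) : Entry κ n :=
  (i (f.1, f.2.1), lab π V f false, lab π V f true)

/-- A choice of representatives of factors: an idempotent map to factors at no later step and with
the same slice index, such that every representative represents at least two factors. -/
structure IsRep (i : Fin L × Fin d → Fin n) (rep : Factor L d → Factor L d) : Prop where
  idem : ∀ f, rep (rep f) = rep f
  step : ∀ f, (rep f).1 ≤ f.1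
  fib : ∀ f, rep f = f → 2 ≤ #{g | rep g = f}
  slice : ∀ f, i ((rep f).1, (rep f).2.1) = i (f.1, f.2.1)

/-- In a word with repeated entries, every factor may be represented by an earliest one with the
same entry. -/
theorem exists_isRep [Nonempty (Factor L d)] {π : Fin L → Equiv.Perm (Pos κ d)}
    {V : Fin (L + 1) → Pos κ d → Fin n} {i : Fin L × Fin d → Fin n}
    (he : ∀ f, ∃ g, g ≠ f ∧ word π V i g = word π V i f) :
    ∃ rep, IsRep i rep ∧ Consistent rep π V ∧
      #{f | rep f = f} = #(univ.image (word π V i)) := by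
  classical
  set e := word π V i
  obtain ⟨f₀⟩ := ‹Nonempty (Factor L d)›
  have hmin : ∀ x : Entry κ n, ∃ g : Factor L d,
      (∃ f, e f = x) → (e g = x ∧ ∀ f, e f = x → g.1 ≤ f.1) := by
    intro x
    by_cases hx : ∃ f, e f = x
    · obtain ⟨f, hf⟩ := hx
      obtain ⟨g, hg, hmin⟩ := exists_min_image (univ.filter fun f => e f = x) (fun f => f.1)
        ⟨f, by simpa using hf⟩
      exact ⟨g, fun _ => ⟨(mem_filter.1 hg).2, fun f hf => hmin f (by simpa using hf)⟩⟩
    · exact ⟨f₀, fun h => absurd h hx⟩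
  choose R hR using hmin
  have hRe : ∀ f, e (R (e f)) = e f := fun f => (hR (e f) ⟨f, rfl⟩).1
  refine ⟨fun f => R (e f), ⟨fun f => by simp only [hRe], fun f => (hR (e f) ⟨f, rfl⟩).2 f rfl,
    fun f hf => ?_, fun f => congrArg Prod.fst (hRe f)⟩, fun f b => ?_, ?_⟩
  · obtain ⟨g, hgf, hg⟩ := he f
    refine one_lt_card.2 ⟨f, by simpa using hf, g, ?_, hgf.symm⟩
    simp only [mem_filter, mem_univ, true_and, hg, hf]
  · cases b
    · exact (congrArg (fun x => x.2.1) (hRe f)).symm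
    · exact (congrArg (fun x => x.2.2) (hRe f)).symm
  · refine card_nbij e (fun f _ => by simp) (fun f hf g hg h => ?_) fun x hx => ?_
    · simp only [coe_filter, mem_univ, true_and, Set.mem_ofPred_eq] at hf hg
      rw [← hf, ← hg, h]
    · obtain ⟨f, -, rfl⟩ := mem_image.1 (mem_coe.1 hx)
      exact ⟨R (e f), by simp [hRe], hRe f⟩

open Classical in
/-- There are two factors for each pair `(t, j)`, and a representative has the same slice index. -/
theorem card_isRep_le (i : Fin L × Fin d → Fin n) :
    #{rep : Factor L d → Factor L d | IsRep i rep} ≤ ∏ p, (2 * #{p' | i p' = i p}) ^ 2 := by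
  calc #{rep : Factor L d → Factor L d | IsRep i rep}
      ≤ #(Fintype.piFinset fun f : Factor L d =>
          ({g | i (g.1, g.2.1) = i (f.1, f.2.1)} : Finset (Factor L d))) := by
        refine card_le_card fun rep hrep => ?_
        rw [Fintype.mem_piFinset]
        exact fun f => by simpa using (mem_filter.1 hrep).2.slice f
    _ = ∏ f : Factor L d, 2 * #{p' | i p' = i (f.1, f.2.1)} := by
        rw [Fintype.card_piFinset]
        refine prod_congr rfl fun f _ => ?_
        simp only [card_filter]
        rw [Fintype.sum_prod_type, Fintype.sum_prod_type, mul_sum]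
        refine sum_congr rfl fun t _ => ?_
        rw [Fintype.sum_prod_type, mul_sum]
        exact sum_congr rfl fun j _ => by
          by_cases h : i (t, j) = i (f.1, f.2.1) <;> simp [h]
    _ = _ := by
        rw [Fintype.prod_prod_type, Fintype.prod_prod_type]
        refine prod_congr rfl fun t _ => ?_
        rw [Fintype.prod_prod_type]
        exact prod_congr rfl fun j _ => by simp [sq]

/-- Every slice index is shared by at least two pairs: the factor equal to `(t, j, 0)` is not
`(t, j, 1)` because the diagonal was removed. -/
theorem two_le_card_slice {π : Fin L → Equiv.Perm (Pos κ d)} {V : Fin (L + 1) → Pos κ d → Fin n}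
    {i : Fin L × Fin d → Fin n} (he : ∀ f, ∃ g, g ≠ f ∧ word π V i g = word π V i f)
    (hod : ∀ t j, word π V i (t, j, 0) ≠ word π V i (t, j, 1)) (p : Fin L × Fin d) :
    2 ≤ #{p' | i p' = i p} := by
  obtain ⟨⟨t, j, h⟩, hne, hw⟩ := he (p.1, p.2, 0)
  refine one_lt_card.2 ⟨p, by simp, (t, j), ?_, ?_⟩
  · rw [mem_filter]
    exact ⟨mem_univ _, congrArg Prod.fst hw⟩
  · rintro rfl
    fin_cases h
    · exact hne rfl
    · exact hod t j hw.symm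

end Words

/-! ### The total weight of all words -/

section Bound

variable {κ d n L : ℕ}

/-- `T ^ 4 ≤ n` lets the free labels lost to repeated entries pay for their multiplicities. -/
theorem excess_mul_pow_le {κ P b n : ℕ} (hκ : 1 ≤ κ) (hb : b ≤ P)
    (hT : (2 * κ * P) ^ 4 ≤ n) :
    (2 * P : ℝ) ^ (2 * P - 2 * b) * (2 * κ * P : ℝ) ^ (κ * (2 * P - 2 * b)) * (2 * n : ℝ) ^ (κ * b)
      ≤ (2 * n : ℝ) ^ (κ * P) := by
  obtain ⟨r, rfl⟩ := Nat.exists_eq_add_of_le hb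
  rw [show 2 * (b + r) - 2 * b = 2 * r by omega]
  set T : ℝ := 2 * κ * ((b + r : ℕ) : ℝ) with hTdef
  have hT' : T ^ 4 ≤ n := by rw [hTdef]; exact_mod_cast hT
  rcases Nat.eq_zero_or_pos r with rfl | hr
  · simp
  have hκ' : (1 : ℝ) ≤ κ := by exact_mod_cast hκ
  have hr' : (1 : ℝ) ≤ ((b + r : ℕ) : ℝ) := by exact_mod_cast (by omega : 1 ≤ b + r)
  have hT1 : 1 ≤ T := by rw [hTdef]; nlinarith
  have hE : 2 * ((b + r : ℕ) : ℝ) ≤ T := by rw [hTdef]; nlinarith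
  calc (2 * ((b + r : ℕ) : ℝ)) ^ (2 * r) * T ^ (κ * (2 * r)) * (2 * n : ℝ) ^ (κ * b)
      ≤ T ^ (2 * r) * T ^ (κ * (2 * r)) * (2 * n : ℝ) ^ (κ * b) := by gcongr
    _ = T ^ (2 * r + κ * (2 * r)) * (2 * n : ℝ) ^ (κ * b) := by rw [pow_add]
    _ ≤ T ^ (4 * (κ * r)) * (2 * n : ℝ) ^ (κ * b) := by
        gcongr ?_ * _
        exact pow_le_pow_right₀ hT1 (by nlinarith)
    _ = (T ^ 4) ^ (κ * r) * (2 * n : ℝ) ^ (κ * b) := by rw [pow_mul]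
    _ ≤ (2 * n : ℝ) ^ (κ * r) * (2 * n : ℝ) ^ (κ * b) := by
        gcongr
        have : (0 : ℝ) ≤ n := Nat.cast_nonneg n
        linarith
    _ = _ := by rw [← pow_add]; congr 1; ring

open Classical in
/-- The weight of all words with a given choice of representatives. Dividing by the number of
permutations of the old positions gains a power of `κ d`. -/
theorem sum_consistent_weight_le (hκ : 1 ≤ κ) (hd : 1 ≤ d) (hL : 1 ≤ L)
    {i : Fin L × Fin d → Fin n} {rep : Factor L d → Factor L d} (h : IsRep i rep)
    (hn : (2 * κ * (L * d)) ^ 4 ≤ n) (hn' : 2 * κ * d + κ * (L * d) ≤ n) :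
    (∑ π : Fin L → Equiv.Perm (Pos κ d), ∑ V : Fin (L + 1) → Pos κ d → Fin n,
        (if Consistent rep π V then (1 : ℝ) else 0))
        * (2 * (L * d : ℕ) : ℝ) ^ (2 * (L * d) - 2 * #{f | rep f = f})
      ≤ (Fintype.card (Equiv.Perm (Pos κ d)) : ℝ) ^ L
        * ((2 * n : ℝ) ^ (2 * κ * d) * ((2 * Real.exp 1 * n) / (κ * d)) ^ (κ * (L * d))) := by
  set P := L * d with hP
  set b := #{f | rep f = f} with hb
  have hP1 : 1 ≤ P := Nat.mul_pos hL hd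
  have hbP : b ≤ P := card_new_le h.idem h.fib
  have hcard : Fintype.card (Factor L d) = 2 * P := card_factor
  have key := sum_consistent_mul_le (κ := κ) (n := n) h.idem h.step h.fib (T := 2 * κ * P)
    (Nat.mul_pos (Nat.mul_pos two_pos hκ) hP1)
    (by rw [hcard]; exact (by ring : κ * (2 * P) = 2 * κ * P).le)
  rw [card_newSlot, hcard, ← hb] at key
  set S := ∑ π : Fin L → Equiv.Perm (Pos κ d), ∑ V : Fin (L + 1) → Pos κ d → Fin n,
    (if Consistent rep π V then 1 else 0) with hS
  have hSr : (∑ π : Fin L → Equiv.Perm (Pos κ d), ∑ V : Fin (L + 1) → Pos κ d → Fin n,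
      (if Consistent rep π V then (1 : ℝ) else 0)) = S := by
    rw [hS]; push_cast; rfl
  rw [hSr]
  set m := Fintype.card (Equiv.Perm (Pos κ d))
  have hNS : 2 * κ * d + κ * b ≤ n := le_trans (by gcongr) hn'
  have key' : (S : ℝ) * ∏ t, ((Fintype.card (OldPos κ rep t)).factorial : ℝ)
      ≤ (m : ℝ) ^ L * ((2 * κ * P : ℝ) ^ (κ * (2 * P - 2 * b))
        * (2 * n : ℝ) ^ (2 * κ * d + κ * b)) := by
    calc (S : ℝ) * ∏ t, ((Fintype.card (OldPos κ rep t)).factorial : ℝ)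
        ≤ (m : ℝ) ^ L * ((2 * κ * P : ℝ) ^ (κ * (2 * P - 2 * b))
          * ((n : ℝ) + (2 * κ * d + κ * b : ℕ)) ^ (2 * κ * d + κ * b)) := by exact_mod_cast key
      _ ≤ _ := by
          gcongr
          have : ((2 * κ * d + κ * b : ℕ) : ℝ) ≤ n := by exact_mod_cast hNS
          linarith
  have hy : (1 : ℝ) ≤ κ * d := by exact_mod_cast Nat.mul_pos hκ hd
  have hfac := pow_le_prod_factorial (fun t => Fintype.card (OldPos κ rep t)) hy (N := κ * P) (by
    have := sum_card_oldPos (κ := κ) rep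
    have h2 : κ * b ≤ κ * P := Nat.mul_le_mul_left _ hbP
    rw [← hb, ← hP, show κ * (2 * P) = κ * P + κ * P by ring] at this
    omega)
  -- at least half of the positions are old, so that the sizes add up to `κ P` at least
  have hexp : Real.exp (Fintype.card (Fin L) * ((κ : ℝ) * d)) = Real.exp 1 ^ (κ * P) := by
    rw [← Real.exp_nat_mul, mul_one, Fintype.card_fin, hP]; push_cast; ring_nf
  rw [hexp] at hfac
  set F := ∏ t, ((Fintype.card (OldPos κ rep t)).factorial : ℝ)
  have hmid : (S : ℝ) * (2 * (P : ℝ)) ^ (2 * P - 2 * b) * F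
      ≤ (m : ℝ) ^ L * ((2 * n : ℝ) ^ (2 * κ * d) * (2 * n : ℝ) ^ (κ * P)) := by
    calc (S : ℝ) * (2 * (P : ℝ)) ^ (2 * P - 2 * b) * F
        = (S : ℝ) * F * (2 * (P : ℝ)) ^ (2 * P - 2 * b) := by ring
      _ ≤ (m : ℝ) ^ L * ((2 * κ * P : ℝ) ^ (κ * (2 * P - 2 * b))
            * (2 * n : ℝ) ^ (2 * κ * d + κ * b)) * (2 * (P : ℝ)) ^ (2 * P - 2 * b) := by gcongr
      _ = (m : ℝ) ^ L * ((2 * n : ℝ) ^ (2 * κ * d) * ((2 * (P : ℝ)) ^ (2 * P - 2 * b)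
            * (2 * κ * P : ℝ) ^ (κ * (2 * P - 2 * b)) * (2 * n : ℝ) ^ (κ * b))) := by
          rw [pow_add]; ring
      _ ≤ _ := by
          gcongr
          exact excess_mul_pow_le hκ hbP hn
  rw [div_pow, ← mul_div_assoc, ← mul_div_assoc, le_div_iff₀ (by positivity)]
  calc (S : ℝ) * (2 * (P : ℝ)) ^ (2 * P - 2 * b) * ((κ : ℝ) * d) ^ (κ * P)
      ≤ (S : ℝ) * (2 * (P : ℝ)) ^ (2 * P - 2 * b) * (Real.exp 1 ^ (κ * P) * F) := by gcongr
    _ = (S : ℝ) * (2 * (P : ℝ)) ^ (2 * P - 2 * b) * F * Real.exp 1 ^ (κ * P) := by ring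
    _ ≤ (m : ℝ) ^ L * ((2 * n : ℝ) ^ (2 * κ * d) * (2 * n : ℝ) ^ (κ * P))
          * Real.exp 1 ^ (κ * P) := by gcongr
    _ = _ := by rw [mul_right_comm (2 : ℝ), mul_pow (2 * (n : ℝ))]; ring

open Classical in
/-- The total weight of all words with no diagonal pair, when a word with an unrepeated entry has
weight at most zero. -/
theorem sum_word_weight_le (hκ : 1 ≤ κ) (hd : 1 ≤ d) {ℓ : ℕ} (hL : L = 2 * ℓ) (hℓ : 1 ≤ ℓ)
    (hn : (2 * κ * (L * d)) ^ 4 ≤ n) (hn' : 2 * κ * d + κ * (L * d) ≤ n)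
    (hn'' : (L * d) ^ 13 ≤ n) {c : ℝ} (hc : 0 ≤ c) (M : (Factor L d → Entry κ n) → ℝ)
    (hM0 : ∀ e, (∃ f, ∀ g, g ≠ f → e g ≠ e f) → M e ≤ 0)
    (hM : ∀ e, (∀ f, ∃ g, g ≠ f ∧ e g = e f) →
      M e ≤ c ^ (2 * (L * d)) * (2 * (L * d : ℕ) : ℝ) ^ (2 * (L * d) - 2 * #(univ.image e))) :
    ∑ π : Fin L → Equiv.Perm (Pos κ d), ∑ V : Fin (L + 1) → Pos κ d → Fin n,
        ∑ i : Fin L × Fin d → Fin n,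
          (if ∀ t j, word π V i (t, j, 0) ≠ word π V i (t, j, 1) then M (word π V i) else 0)
      ≤ (Fintype.card (Equiv.Perm (Pos κ d)) : ℝ) ^ L
        * (c ^ (2 * (L * d)) * ((2 * n : ℝ) ^ (2 * κ * d)
            * ((2 * Real.exp 1 * n) / (κ * d)) ^ (κ * (L * d)))
          * ((32 * Real.exp 1) ^ (L * d) * ((n : ℝ) * (L * d : ℕ)) ^ (ℓ * d))) := by
  set P := L * d with hP
  have hL1 : 1 ≤ L := by omega
  have hPQ : P = 2 * (ℓ * d) := by rw [hP, hL]; ring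
  have hne : Nonempty (Factor L d) := ⟨(⟨0, by omega⟩, ⟨0, by omega⟩, 0)⟩
  set K : ℝ := (2 * n : ℝ) ^ (2 * κ * d) * ((2 * Real.exp 1 * n) / (κ * d)) ^ (κ * P) with hK
  set m : ℝ := (Fintype.card (Equiv.Perm (Pos κ d)) : ℝ) ^ L with hm
  have hK0 : 0 ≤ K := by positivity
  have hm0 : 0 ≤ m := by positivity
  set G : (Fin L × Fin d → Fin n) → Prop := fun i => ∀ p, 2 ≤ #{p' | i p' = i p} with hG
  set W : (Factor L d → Factor L d) → ℝ := fun rep =>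
    c ^ (2 * P) * (2 * (P : ℝ)) ^ (2 * P - 2 * #{f | rep f = f}) with hW
  have hW0 : ∀ rep, 0 ≤ W rep := fun rep => by positivity
  have hpt : ∀ (π : Fin L → Equiv.Perm (Pos κ d)) (V : Fin (L + 1) → Pos κ d → Fin n)
      (i : Fin L × Fin d → Fin n),
      (if ∀ t j, word π V i (t, j, 0) ≠ word π V i (t, j, 1) then M (word π V i) else 0)
        ≤ if G i then ∑ rep : Factor L d → Factor L d with IsRep i rep,
            (if Consistent rep π V then 1 else 0) * W rep else 0 := by
    intro π V i
    have hnn : 0 ≤ ∑ rep : Factor L d → Factor L d with IsRep i rep,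
            (if Consistent rep π V then (1 : ℝ) else 0) * W rep :=
      sum_nonneg fun rep _ => mul_nonneg (by split_ifs <;> norm_num) (hW0 rep)
    by_cases hod : ∀ t j, word π V i (t, j, 0) ≠ word π V i (t, j, 1)
    · rw [if_pos hod]
      by_cases he : ∀ f, ∃ g, g ≠ f ∧ word π V i g = word π V i f
      · rw [if_pos (show G i from fun p => two_le_card_slice he hod p)]
        obtain ⟨rep, hrep, hcons, hcard⟩ := exists_isRep he
        refine (hM _ he).trans ?_
        rw [← hcard]
        refine le_trans (le_of_eq ?_) (single_le_sum (f := fun rep =>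
          (if Consistent rep π V then (1 : ℝ) else 0) * W rep) (fun rep _ =>
            mul_nonneg (by split_ifs <;> norm_num) (hW0 rep))
          (mem_filter.2 ⟨mem_univ rep, hrep⟩))
        simp only [if_pos hcons, one_mul, hW]
      · push Not at he
        refine (hM0 _ he).trans ?_
        split_ifs
        · exact hnn
        · exact le_rfl
    · rw [if_neg hod]
      split_ifs
      · exact hnn
      · exact le_rfl
  have hrepsum : ∀ i : Fin L × Fin d → Fin n, ∀ rep, IsRep i rep →
      ∑ π : Fin L → Equiv.Perm (Pos κ d), ∑ V : Fin (L + 1) → Pos κ d → Fin n,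
        (if Consistent rep π V then (1 : ℝ) else 0) * W rep ≤ m * (c ^ (2 * P) * K) := by
    intro i rep hrep
    simp only [← sum_mul]
    have := sum_consistent_weight_le hκ hd hL1 hrep hn hn'
    calc _ = c ^ (2 * P) * ((∑ π : Fin L → Equiv.Perm (Pos κ d),
            ∑ V : Fin (L + 1) → Pos κ d → Fin n, (if Consistent rep π V then (1 : ℝ) else 0))
            * (2 * (P : ℝ)) ^ (2 * P - 2 * #{f | rep f = f})) := by rw [hW]; ring
      _ ≤ c ^ (2 * P) * (m * K) := by gcongr
      _ = _ := by ring
  calc _ ≤ ∑ π : Fin L → Equiv.Perm (Pos κ d), ∑ V : Fin (L + 1) → Pos κ d → Fin n,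
        ∑ i : Fin L × Fin d → Fin n, (if G i then
          ∑ rep : Factor L d → Factor L d with IsRep i rep,
            (if Consistent rep π V then 1 else 0) * W rep else 0) :=
        sum_le_sum fun π _ => sum_le_sum fun V _ => sum_le_sum fun i _ => hpt π V i
    _ = ∑ i : Fin L × Fin d → Fin n with G i, ∑ rep : Factor L d → Factor L d with IsRep i rep,
          ∑ π : Fin L → Equiv.Perm (Pos κ d), ∑ V : Fin (L + 1) → Pos κ d → Fin n,
            (if Consistent rep π V then 1 else 0) * W rep := by
        simp only [← sum_filter G]
        rw [sum_congr rfl fun π _ => sum_comm, sum_comm]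
        refine sum_congr rfl fun i _ => ?_
        rw [sum_congr rfl fun π _ => sum_comm, sum_comm]
    _ ≤ ∑ i : Fin L × Fin d → Fin n with G i, ∑ rep : Factor L d → Factor L d with IsRep i rep,
          m * (c ^ (2 * P) * K) :=
        sum_le_sum fun i _ => sum_le_sum fun rep hrep => hrepsum i rep (mem_filter.1 hrep).2
    _ = ∑ i : Fin L × Fin d → Fin n with G i,
          (#{rep : Factor L d → Factor L d | IsRep i rep} : ℝ) * (m * (c ^ (2 * P) * K)) :=
        sum_congr rfl fun i _ => by rw [sum_const, nsmul_eq_mul]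
    _ ≤ ∑ i : Fin L × Fin d → Fin n with G i,
          (∏ p, ((2 * #{p' | i p' = i p} : ℕ) : ℝ) ^ 2) * (m * (c ^ (2 * P) * K)) := by
        refine sum_le_sum fun i _ => mul_le_mul_of_nonneg_right ?_ (by positivity)
        exact_mod_cast card_isRep_le i
    _ = m * (c ^ (2 * P) * K * ∑ i : Fin L × Fin d → Fin n with G i,
          ∏ p, ((2 * #{p' | i p' = i p} : ℕ) : ℝ) ^ 2) := by rw [← sum_mul]; ring
    _ ≤ _ := by
        have hs := sum_slice_weight_le (ι := Fin L × Fin d) (n := n) (Q := ℓ * d)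
          (by simp [← hPQ, hP]) (Nat.mul_pos hℓ hd) (by rw [← hPQ]; exact hn'')
        have hcast : (2 * ((ℓ * d : ℕ) : ℝ)) = (P : ℝ) := by rw [hPQ]; push_cast; ring
        rw [hcast, ← hPQ] at hs
        gcongr

end Bound

/-! ### Spectral norm, traces and averaging over permutations -/

section Norm

open Matrix

variable {ι : Type} [Fintype ι] [DecidableEq ι]

/-- The spectral norm is at most the Frobenius norm. -/
theorem specNorm_sq_le (B : Matrix ι ι ℝ) : specNorm B ^ 2 ≤ ∑ u, ∑ v, B u v ^ 2 := by
  have h0 : 0 ≤ ∑ u, ∑ v, B u v ^ 2 := sum_nonneg fun _ _ => sum_nonneg fun _ _ => sq_nonneg _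
  have h : specNorm B ≤ Real.sqrt (∑ u, ∑ v, B u v ^ 2) := by
    refine ContinuousLinearMap.opNorm_le_bound _ (Real.sqrt_nonneg _) fun x => ?_
    rw [EuclideanSpace.norm_eq, EuclideanSpace.norm_eq, ← Real.sqrt_mul h0]
    refine Real.sqrt_le_sqrt ?_
    simp only [Real.norm_eq_abs, sq_abs]
    rw [sum_mul]
    refine sum_le_sum fun u _ => ?_
    have : (toEuclideanCLM (n := ι) (𝕜 := ℝ) B x) u = ∑ v, B u v * x v := rfl
    rw [this]
    exact sum_mul_sq_le_sq_mul_sq _ _ _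
  calc specNorm B ^ 2 ≤ Real.sqrt (∑ u, ∑ v, B u v ^ 2) ^ 2 := by
        gcongr; exact norm_nonneg _
    _ = _ := Real.sq_sqrt h0

open scoped Matrix.Norms.L2Operator in
/-- The spectral norm is bounded by the trace of a power: with `Y = C Cᵀ` symmetric, `‖C‖² = ‖Y‖`,
`‖Y‖ ^ 2^s = ‖Y ^ 2^s‖`, and the Frobenius norm bounds the latter. -/
theorem specNorm_pow_le_trace (C : Matrix ι ι ℝ) (s : ℕ) :
    specNorm C ^ (2 * 2 ^ (s + 1)) ≤ ((C * Cᵀ) ^ 2 ^ (s + 1)).trace := by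
  set Y := C * Cᵀ with hY
  have hYt : Yᵀ = Y := by rw [hY, transpose_mul, transpose_transpose]
  have hstar : star C = Cᵀ := by
    rw [star_eq_conjTranspose, conjTranspose_eq_transpose_of_trivial]
  have h1 : specNorm C ^ 2 = specNorm Y := by
    change ‖C‖ ^ 2 = ‖Y‖
    rw [hY, ← hstar, CStarRing.norm_self_mul_star, sq]
  have hsa : IsSelfAdjoint Y := by
    rw [isSelfAdjoint_iff, star_eq_conjTranspose, conjTranspose_eq_transpose_of_trivial, hYt]
  have h2 : specNorm Y ^ 2 ^ s = specNorm (Y ^ 2 ^ s) := by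
    change ‖Y‖ ^ 2 ^ s = ‖Y ^ 2 ^ s‖
    rw [hsa.norm_pow_two_pow]
  have h3 : ∑ u, ∑ v, (Y ^ 2 ^ s) u v ^ 2 = (Y ^ 2 ^ (s + 1)).trace := by
    have : Y ^ 2 ^ (s + 1) = Y ^ 2 ^ s * (Y ^ 2 ^ s)ᵀ := by
      rw [transpose_pow, hYt, ← pow_add, pow_succ, mul_two]
    rw [this, trace]
    simp only [diag_apply, mul_apply, transpose_apply, sq]
  rw [← h3, pow_mul, h1, pow_succ, pow_mul, h2]
  exact specNorm_sq_le _

/-- The product `D 0 * D 1 * ⋯ * D (L - 1)`. -/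
def walkProd (D : ℕ → Matrix ι ι ℝ) : ℕ → Matrix ι ι ℝ
  | 0 => 1
  | L + 1 => walkProd D L * D L

theorem walkProd_apply (D : ℕ → Matrix ι ι ℝ) (L : ℕ) (u v : ι) :
    walkProd D L u v = ∑ w : Fin (L + 1) → ι,
      if w 0 = u ∧ w (Fin.last L) = v then ∏ t : Fin L, D t (w t.castSucc) (w t.succ) else 0 := by
  induction L generalizing v with
  | zero =>
    rw [walkProd, ← (Equiv.funUnique (Fin 1) ι).symm.sum_comp]
    simp [one_apply, ite_and]
  | succ L ih =>
    rw [walkProd, mul_apply, ← (Fin.snocEquiv fun _ : Fin (L + 2) => ι).sum_comp,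
      Fintype.sum_prod_type]
    have hsnoc : ∀ (x : ι) (w : Fin (L + 1) → ι),
        (if (Fin.snoc w x : Fin (L + 2) → ι) 0 = u ∧
            (Fin.snoc w x : Fin (L + 2) → ι) (Fin.last (L + 1)) = v then
          ∏ t : Fin (L + 1), D t ((Fin.snoc w x : Fin (L + 2) → ι) t.castSucc)
            ((Fin.snoc w x : Fin (L + 2) → ι) t.succ) else 0)
          = if x = v then (if w 0 = u then
              (∏ t : Fin L, D t (w t.castSucc) (w t.succ)) * D L (w (Fin.last L)) x else 0)
            else 0 := by
      intro x w
      have h0 : (Fin.snoc w x : Fin (L + 2) → ι) 0 = w 0 := by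
        rw [← Fin.castSucc_zero, Fin.snoc_castSucc]
      rw [h0, Fin.snoc_last, Fin.prod_univ_castSucc]
      simp only [Fin.snoc_castSucc, Fin.succ_castSucc, Fin.succ_last, Fin.snoc_last,
        Fin.val_castSucc, Fin.val_last]
      by_cases h1 : x = v <;> by_cases h2 : w 0 = u <;> simp [h1, h2]
    have hgoal : ∀ (x : ι) (w : Fin (L + 1) → ι),
      (Fin.snocEquiv fun _ : Fin (L + 2) => ι) (x, w) = Fin.snoc w x := fun x w => rfl
    simp only [hgoal, hsnoc]
    rw [sum_comm]
    simp only [sum_ite_eq', mem_univ, if_true, ih, sum_mul]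
    rw [sum_comm]
    refine sum_congr rfl fun w _ => ?_
    simp only [ite_mul, zero_mul, ite_and]
    by_cases h : w 0 = u <;> simp [h]

theorem trace_walkProd (D : ℕ → Matrix ι ι ℝ) (L : ℕ) :
    (walkProd D L).trace = ∑ w : Fin (L + 1) → ι,
      if w 0 = w (Fin.last L) then ∏ t : Fin L, D t (w t.castSucc) (w t.succ) else 0 := by
  simp only [trace, diag_apply, walkProd_apply]
  rw [sum_comm]
  refine sum_congr rfl fun w _ => ?_
  simp only [ite_and]
  rw [sum_ite_eq]
  simp [eq_comm]

theorem walkProd_alternating (X Y : Matrix ι ι ℝ) (ℓ : ℕ) :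
    walkProd (fun t => if t.bodd then Y else X) (2 * ℓ) = (X * Y) ^ ℓ := by
  induction ℓ with
  | zero => rfl
  | succ ℓ ih =>
    rw [mul_add, walkProd, walkProd, ih, pow_succ, Matrix.mul_assoc]
    simp

end Norm

section Average

open Matrix

variable {P α : Type} [Fintype P] [DecidableEq P] [DecidableEq α]

/-- The average of the permutation matrices of all permutations of the index positions: the
orthogonal projection onto the symmetric tensors. -/
noncomputable def symProj (P α : Type) [Fintype P] [DecidableEq P] [DecidableEq α] :
    Matrix (P → α) (P → α) ℝ :=
  (Fintype.card (Equiv.Perm P) : ℝ)⁻¹ •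
    ∑ π : Equiv.Perm P, (1 : Matrix (P → α) (P → α) ℝ).submatrix (fun U => U ∘ π) id

theorem transpose_symProj : (symProj P α)ᵀ = symProj P α := by
  rw [symProj, transpose_smul, transpose_sum]
  congr 1
  rw [← Equiv.sum_comp (Equiv.inv (Equiv.Perm P))]
  refine sum_congr rfl fun π _ => ?_
  ext U V
  simp only [transpose_apply, submatrix_apply, id, one_apply, Equiv.inv_apply]
  have : V ∘ ⇑π⁻¹ = U ↔ U ∘ π = V := by
    constructor
    · rintro rfl; ext x; simp
    · rintro rfl; ext x; simp
  simp only [this]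

variable [Fintype α]

theorem symProj_mul (W : Matrix (P → α) (P → α) ℝ) :
    symProj P α * W = (Fintype.card (Equiv.Perm P) : ℝ)⁻¹ •
      ∑ π : Equiv.Perm P, W.submatrix (fun U => U ∘ π) id := by
  rw [symProj, smul_mul_assoc, sum_mul]
  congr 1
  refine sum_congr rfl fun π _ => ?_
  ext U V
  simp [mul_apply, one_apply]

theorem mul_symProj (W : Matrix (P → α) (P → α) ℝ) :
    W * symProj P α = (Fintype.card (Equiv.Perm P) : ℝ)⁻¹ •
      ∑ π : Equiv.Perm P, W.submatrix id (fun U => U ∘ π) := by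
  have h := congrArg transpose (symProj_mul (Wᵀ))
  rw [transpose_mul, transpose_transpose, transpose_symProj, transpose_smul, transpose_sum] at h
  rw [h]
  rfl

theorem symProj_mul_self : symProj P α * symProj P α = symProj P α := by
  have hinv : ∀ π : Equiv.Perm P,
      (symProj P α).submatrix (fun U => U ∘ π) id = symProj P α := by
    intro π
    ext U V
    simp only [symProj, submatrix_apply, Matrix.smul_apply, Matrix.sum_apply, id]
    congr 1
    exact Equiv.sum_comp (Equiv.mulLeft π) fun ρ : Equiv.Perm P =>
      (1 : Matrix (P → α) (P → α) ℝ) (U ∘ ρ) V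
  rw [symProj_mul, sum_congr rfl fun π _ => hinv π, sum_const, card_univ,
    ← Nat.cast_smul_eq_nsmul ℝ, smul_smul,
    inv_mul_cancel₀ (by exact_mod_cast Fintype.card_ne_zero), one_smul]

/-- The certificate matrix is the compression of the tensor power to the symmetric tensors. -/
theorem symmetrize_eq (W : Matrix (P → α) (P → α) ℝ) :
    symmetrize W = symProj P α * W * symProj P α := by
  rw [mul_symProj, symProj_mul, symmetrize, sum_comm, sq, mul_inv, ← smul_smul]
  congr 1
  rw [smul_sum]
  refine sum_congr rfl fun σ _ => ?_
  ext U V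
  simp [Matrix.sum_apply]

/-- Inside the trace, a single projection between two consecutive matrices suffices. -/
theorem trace_symmetrize_pow (W : Matrix (P → α) (P → α) ℝ) (ℓ : ℕ) :
    ((symmetrize W * (symmetrize W)ᵀ) ^ (ℓ + 1)).trace
      = ((symProj P α * W * (symProj P α * Wᵀ)) ^ (ℓ + 1)).trace := by
  set A := symProj P α with hA
  have hAA : A * A = A := symProj_mul_self
  set X := A * W * (A * Wᵀ) with hX
  have hY : symmetrize W * (symmetrize W)ᵀ = X * A := by
    rw [symmetrize_eq, transpose_mul, transpose_mul, transpose_symProj, hX]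
    simp only [← hA, Matrix.mul_assoc]
    rw [← Matrix.mul_assoc A A, hAA]
  have hAX : A * X = X := by rw [hX, ← Matrix.mul_assoc A, ← Matrix.mul_assoc A A, hAA]
  have hpow : ∀ ℓ : ℕ, (X * A) ^ (ℓ + 1) = X ^ (ℓ + 1) * A := by
    intro ℓ
    induction ℓ with
    | zero => simp
    | succ ℓ ih => rw [pow_succ, ih, pow_succ X (ℓ + 1), Matrix.mul_assoc, ← Matrix.mul_assoc A X,
        hAX, ← Matrix.mul_assoc]
  rw [hY, hpow, trace_mul_comm, pow_succ', ← Matrix.mul_assoc, hAX]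

end Average

/-! ### Expansion of the trace -/

section Expansion

open Matrix

variable {κ d n L : ℕ}

/-- The entry of the asymmetrized tensor at a given slice, row and column. -/
noncomputable def entryVal (T : Tensor (2 * κ + 1) n) (e : Entry κ n) : ℝ :=
  OddTensor.slice (asymmetrize T) e.1 e.2.1 e.2.2

theorem diagFree_apply (T : Tensor (2 * κ + 1) n)
    (I J : (Fin κ → Fin n) × (Fin κ → Fin n)) :
    diagFree T I J = if (I.1, J.1) ≠ (I.2, J.2) then
      ∑ i, entryVal T (i, I.1, J.1) * entryVal T (i, I.2, J.2) else 0 := by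
  simp only [diagFree, of_apply, sumKron, Matrix.sum_apply, entryVal]
  rfl

/-- A single step of the walk. The labels entering and leaving a factor are row and column labels
in this order at even steps, and in the opposite order at odd steps. -/
theorem step_apply (T : Tensor (2 * κ + 1) n) (π : Fin L → Equiv.Perm (Pos κ d))
    (V : Fin (L + 1) → Pos κ d → Fin n) (t : Fin L) :
    (if t.val.bodd then (tensorPow d (diagFree T))ᵀ else tensorPow d (diagFree T))
        (V t.castSucc ∘ π t) (V t.succ)
      = ∏ j, if (lab π V (t, j, 0) false, lab π V (t, j, 0) true)
            ≠ (lab π V (t, j, 1) false, lab π V (t, j, 1) true) then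
          ∑ i, entryVal T (i, lab π V (t, j, 0) false, lab π V (t, j, 0) true)
            * entryVal T (i, lab π V (t, j, 1) false, lab π V (t, j, 1) true) else 0 := by
  cases h : t.val.bodd
  · simp only [lab, h, Bool.false_eq_true, if_false, tensorPow, of_apply, diagFree_apply, if_true,
      Bool.true_eq_false]
    rfl
  · simp only [lab, h, if_true, tensorPow, transpose_apply, of_apply, diagFree_apply,
      Bool.false_eq_true, if_false]
    rfl

theorem prod_step_apply (T : Tensor (2 * κ + 1) n) (π : Fin L → Equiv.Perm (Pos κ d))
    (V : Fin (L + 1) → Pos κ d → Fin n) :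
    ∏ t : Fin L, (if t.val.bodd then (tensorPow d (diagFree T))ᵀ else tensorPow d (diagFree T))
        (V t.castSucc ∘ π t) (V t.succ)
      = ∑ i : Fin L × Fin d → Fin n,
          if ∀ t j, word π V i (t, j, 0) ≠ word π V i (t, j, 1) then
            ∏ f, entryVal T (word π V i f) else 0 := by
  simp only [step_apply]
  rw [← Fintype.prod_prod_type' (f := fun (t : Fin L) (j : Fin d) =>
    if (lab π V (t, j, 0) false, lab π V (t, j, 0) true)
            ≠ (lab π V (t, j, 1) false, lab π V (t, j, 1) true) then
          ∑ i, entryVal T (i, lab π V (t, j, 0) false, lab π V (t, j, 0) true)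
            * entryVal T (i, lab π V (t, j, 1) false, lab π V (t, j, 1) true) else 0)]
  have hpush : ∀ p : Fin L × Fin d,
      (if (lab π V (p.1, p.2, 0) false, lab π V (p.1, p.2, 0) true)
            ≠ (lab π V (p.1, p.2, 1) false, lab π V (p.1, p.2, 1) true) then
          ∑ i, entryVal T (i, lab π V (p.1, p.2, 0) false, lab π V (p.1, p.2, 0) true)
            * entryVal T (i, lab π V (p.1, p.2, 1) false, lab π V (p.1, p.2, 1) true) else 0)
      = ∑ i, if (lab π V (p.1, p.2, 0) false, lab π V (p.1, p.2, 0) true)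
            ≠ (lab π V (p.1, p.2, 1) false, lab π V (p.1, p.2, 1) true) then
          entryVal T (i, lab π V (p.1, p.2, 0) false, lab π V (p.1, p.2, 0) true)
            * entryVal T (i, lab π V (p.1, p.2, 1) false, lab π V (p.1, p.2, 1) true) else 0 := by
    intro p
    split_ifs <;> simp
  rw [prod_congr rfl fun p _ => hpush p, prod_univ_sum, Fintype.piFinset_univ]
  refine sum_congr rfl fun i _ => ?_
  rw [prod_ite_zero]
  have hiff : (∀ p ∈ (univ : Finset (Fin L × Fin d)),
      (lab π V (p.1, p.2, 0) false, lab π V (p.1, p.2, 0) true)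
            ≠ (lab π V (p.1, p.2, 1) false, lab π V (p.1, p.2, 1) true))
      ↔ ∀ t j, word π V i (t, j, 0) ≠ word π V i (t, j, 1) := by
    simp [word, Prod.forall]
  simp only [hiff]
  congr 1
  rw [Fintype.prod_prod_type, Fintype.prod_prod_type]
  refine prod_congr rfl fun t _ => ?_
  rw [Fintype.prod_prod_type]
  refine prod_congr rfl fun j _ => ?_
  rw [Fin.prod_univ_two]
  rfl

/-- The trace as an average over permutations of a sum over words. -/
theorem trace_expansion (T : Tensor (2 * κ + 1) n) (d ℓ : ℕ) :
    ((certMatrix d T * (certMatrix d T)ᵀ) ^ (ℓ + 1)).trace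
      = ((Fintype.card (Equiv.Perm (Pos κ d)) : ℝ) ^ (2 * (ℓ + 1)))⁻¹ *
        ∑ π : Fin (2 * (ℓ + 1)) → Equiv.Perm (Pos κ d),
          ∑ V : Fin (2 * (ℓ + 1) + 1) → Pos κ d → Fin n,
            if V 0 = V (Fin.last _) then
              ∑ i : Fin (2 * (ℓ + 1)) × Fin d → Fin n,
                if ∀ t j, word π V i (t, j, 0) ≠ word π V i (t, j, 1) then
                  ∏ f, entryVal T (word π V i f) else 0
            else 0 := by
  set W := tensorPow d (diagFree T) with hW
  set A : Matrix (Pos κ d → Fin n) (Pos κ d → Fin n) ℝ := symProj (Pos κ d) (Fin n)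
  have hfun : (fun t : ℕ => if t.bodd then A * Wᵀ else A * W)
      = fun t : ℕ => A * (if t.bodd then Wᵀ else W) := by
    funext t
    split_ifs <;> rfl
  rw [certMatrix, trace_symmetrize_pow, ← walkProd_alternating, hfun, trace_walkProd, sum_comm,
    mul_sum]
  refine sum_congr rfl fun V _ => ?_
  by_cases hV : V 0 = V (Fin.last _)
  · simp only [if_pos hV]
    have hA : ∀ t : Fin (2 * (ℓ + 1)),
        (A * (if t.val.bodd then Wᵀ else W)) (V t.castSucc) (V t.succ)
        = (Fintype.card (Equiv.Perm (Pos κ d)) : ℝ)⁻¹ * ∑ π : Equiv.Perm (Pos κ d),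
            (if t.val.bodd then Wᵀ else W) (V t.castSucc ∘ π) (V t.succ) := fun t => by
      rw [symProj_mul]
      simp [Matrix.sum_apply, Matrix.smul_apply]
    rw [prod_congr rfl fun t _ => hA t, prod_mul_distrib, prod_const, card_univ, Fintype.card_fin,
      inv_pow, prod_univ_sum, Fintype.piFinset_univ]
    congr 1
    exact sum_congr rfl fun π _ => prod_step_apply T π V
  · simp [if_neg hV]

end Expansion

/-! ### Moments of subgaussian monomials -/

section Moments

open MeasureTheory ProbabilityTheory

variable {Ω : Type*} [MeasurableSpace Ω] {P : Measure Ω}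

/-- The bound on the moment generating function near zero forces the mean to vanish; one half of
this, the other half follows by symmetry. -/
theorem integral_nonpos_of_subgaussian [IsProbabilityMeasure P] {X : Ω → ℝ} {v : ℝ≥0}
    (hX : HasSubgaussianMGF X v P) : ∫ ω, X ω ∂P ≤ 0 := by
  set μ := ∫ ω, X ω ∂P with hμ
  -- `1 + t 𝔼 X ≤ 𝔼 exp (t X) ≤ exp (v t² / 2) ≤ 1 + v t²` for small `t`
  have h1 : ∀ t : ℝ, 1 + t * μ ≤ Real.exp (v * t ^ 2 / 2) := fun t => by
    calc 1 + t * μ = ∫ ω, (1 + t * X ω) ∂P := by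
          rw [integral_add (integrable_const _) (hX.integrable.const_mul t), integral_const_mul]
          simp [hμ]
      _ ≤ ∫ ω, Real.exp (t * X ω) ∂P := by
          refine integral_mono ((integrable_const _).add (hX.integrable.const_mul t))
            (hX.integrable_exp_mul t) fun ω => ?_
          have := Real.add_one_le_exp (t * X ω)
          simp only
          linarith
      _ ≤ _ := hX.mgf_le t
  by_contra hpos
  push Not at hpos
  -- a `t` small enough to contradict `t μ ≤ v t²` if `μ` were positive
  set w : ℝ := v + 1 + μ
  have hv : (0 : ℝ) ≤ v := v.2
  have hw : 0 < w := by positivity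
  have hw1 : 1 ≤ w := by simp only [w]; linarith
  have hvw : (v : ℝ) ≤ w := by simp only [w]; linarith
  set t : ℝ := min (1 / w) (μ / (2 * w)) with ht
  have ht0 : 0 < t := lt_min (by positivity) (by positivity)
  have ht1 : t * w ≤ 1 := (le_div_iff₀ hw).1 (min_le_left _ _)
  have ht2 : t * (2 * w) ≤ μ := (le_div_iff₀ (by positivity)).1 (min_le_right _ _)
  have ht3 : t ≤ 1 := by nlinarith
  have hx0 : 0 ≤ (v : ℝ) * t ^ 2 / 2 := by positivity
  have hvt : v * t ≤ 1 := by nlinarith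
  have hx1 : (v : ℝ) * t ^ 2 / 2 ≤ 1 := by nlinarith
  have h2 := Real.abs_exp_sub_one_le (x := v * t ^ 2 / 2) (by rwa [abs_of_nonneg hx0])
  rw [abs_of_nonneg hx0] at h2
  have h3 := (abs_le.1 h2).2
  have h5 : t * μ ≤ t * (v * t) := by nlinarith [h1 t]
  have h6 : μ ≤ v * t := le_of_mul_le_mul_left h5 ht0
  nlinarith

theorem integral_eq_zero_of_subgaussian [IsProbabilityMeasure P] {X : Ω → ℝ} {v : ℝ≥0}
    (hX : HasSubgaussianMGF X v P) : ∫ ω, X ω ∂P = 0 := by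
  refine le_antisymm (integral_nonpos_of_subgaussian hX) ?_
  have := integral_nonpos_of_subgaussian hX.neg
  simp only [Pi.neg_apply, integral_neg] at this
  linarith

/-- Moments from the moment generating function at `±1`, by `|x| ^ p ≤ p! (eˣ + e⁻ˣ)`. -/
theorem abs_integral_pow_le_of_subgaussian {X : Ω → ℝ} {v : ℝ≥0}
    (hX : HasSubgaussianMGF X v P) (p : ℕ) :
    |∫ ω, X ω ^ p ∂P| ≤ 2 * Real.exp (v / 2) * p.factorial := by
  have hi1 := hX.integrable_exp_mul 1
  have hi2 := hX.integrable_exp_mul (-1)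
  have hm1 : ∫ ω, Real.exp (1 * X ω) ∂P ≤ Real.exp (v / 2) := by
    have := hX.mgf_le 1
    rwa [one_pow, mul_one] at this
  have hm2 : ∫ ω, Real.exp (-1 * X ω) ∂P ≤ Real.exp (v / 2) := by
    have := hX.mgf_le (-1)
    rwa [neg_one_sq, mul_one] at this
  have hpt : ∀ ω, ‖X ω ^ p‖ ≤ p.factorial * (Real.exp (1 * X ω) + Real.exp (-1 * X ω)) := by
    intro ω
    have h1 := Real.pow_div_factorial_le_exp |X ω| (abs_nonneg _) p
    rw [div_le_iff₀ (by positivity)] at h1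
    rw [norm_pow, Real.norm_eq_abs, one_mul, neg_one_mul]
    have h2 : Real.exp |X ω| ≤ Real.exp (X ω) + Real.exp (-X ω) := by
      rcases abs_choice (X ω) with h | h <;> rw [h] <;>
        linarith [Real.exp_pos (X ω), Real.exp_pos (-X ω)]
    calc _ ≤ Real.exp |X ω| * p.factorial := h1
      _ ≤ (Real.exp (X ω) + Real.exp (-X ω)) * p.factorial := by gcongr
      _ = _ := mul_comm _ _
  calc |∫ ω, X ω ^ p ∂P|
      ≤ ∫ ω, p.factorial * (Real.exp (1 * X ω) + Real.exp (-1 * X ω)) ∂P :=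
        norm_integral_le_of_norm_le ((hi1.add hi2).const_mul _) (Filter.Eventually.of_forall hpt)
    _ = p.factorial * (∫ ω, Real.exp (1 * X ω) ∂P + ∫ ω, Real.exp (-1 * X ω) ∂P) := by
        rw [integral_const_mul, integral_add hi1 hi2]
    _ ≤ p.factorial * (Real.exp (v / 2) + Real.exp (v / 2)) := by gcongr
    _ = _ := by ring

theorem factorial_le_two_mul_pow {N : ℕ} (q : ℕ) (hq : q + 2 ≤ N) :
    (q + 2).factorial ≤ 2 * N ^ q := by
  induction q with
  | zero => simp [Nat.factorial]
  | succ q ih =>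
    rw [Nat.factorial_succ, pow_succ]
    calc (q + 1 + 1 + 1) * (q + 2).factorial ≤ N * (2 * N ^ q) :=
          Nat.mul_le_mul (by omega) (ih (by omega))
      _ = _ := by ring

variable {S F : Type*} [Fintype S] [DecidableEq S] [Fintype F] {X : S → Ω → ℝ}

/-- The expectation of a monomial in independent variables factorizes. -/
theorem integral_prod_word_eq (hX : iIndepFun X P) (hm : ∀ a, AEMeasurable (X a) P)
    (s : F → S) :
    ∫ ω, ∏ f, X (s f) ω ∂P = ∏ a, ∫ ω, X a ω ^ #{f | s f = a} ∂P := by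
  have h : ∀ ω, ∏ f, X (s f) ω = ∏ a, X a ω ^ #{f | s f = a} := fun ω => by
    rw [← prod_fiberwise univ s]
    refine prod_congr rfl fun a _ => ?_
    rw [prod_congr rfl fun f hf => by rw [(mem_filter.1 hf).2], prod_const]
  simp only [h]
  exact hX.integral_fun_prod_comp (f := fun a x => x ^ #{f | s f = a}) hm
    fun a => (continuous_pow _).aestronglyMeasurable

theorem integral_prod_word_eq_zero (hX : iIndepFun X P) (hm : ∀ a, AEMeasurable (X a) P)
    (h0 : ∀ a, ∫ ω, X a ω ∂P = 0) (s : F → S) (hs : ∃ f, ∀ g, g ≠ f → s g ≠ s f) :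
    ∫ ω, ∏ f, X (s f) ω ∂P = 0 := by
  obtain ⟨f, hf⟩ := hs
  rw [integral_prod_word_eq hX hm]
  refine prod_eq_zero (mem_univ (s f)) ?_
  have : #{g | s g = s f} = 1 := by
    rw [card_eq_one]
    refine ⟨f, ?_⟩
    ext g
    simp only [mem_filter, mem_univ, true_and, mem_singleton]
    exact ⟨fun h => by_contra fun hne => hf g hne h, fun h => by rw [h]⟩
  simp only [this, pow_one, h0]

/-- A monomial in independent variables in which every variable is repeated. A variable of
multiplicity `q + 2` contributes a factor of the order of `N ^ q` at most, where `N` is the degree.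
-/
theorem abs_integral_prod_word_le (hX : iIndepFun X P) (hm : ∀ a, AEMeasurable (X a) P)
    {K B : ℝ} (hK : 0 ≤ K) (hB : 1 ≤ B)
    (hmom : ∀ a p, |∫ ω, X a ω ^ p ∂P| ≤ K ^ p * (B * p.factorial)) (s : F → S)
    (hs : ∀ f, ∃ g, g ≠ f ∧ s g = s f) :
    |∫ ω, ∏ f, X (s f) ω ∂P| ≤ (K * (2 * B)) ^ Fintype.card F
      * (Fintype.card F : ℝ) ^ (Fintype.card F - 2 * #(univ.image s)) := by
  have := hX.isProbabilityMeasure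
  set N := Fintype.card F with hN
  have hsum : ∑ a ∈ univ.image s, #{f | s f = a} = N := by
    rw [← card_eq_sum_card_image, card_univ]
  have h2 : ∀ a ∈ univ.image s, 2 ≤ #{f | s f = a} := fun a ha => by
    obtain ⟨f, -, rfl⟩ := mem_image.1 ha
    obtain ⟨g, hgf, hg⟩ := hs f
    exact one_lt_card.2 ⟨f, by simp, g, by simpa using hg, hgf.symm⟩
  have hexc : ∑ a ∈ univ.image s, (#{f | s f = a} - 2) = N - 2 * #(univ.image s) := by
    have : ∑ a ∈ univ.image s, (#{f | s f = a} - 2) + 2 * #(univ.image s) = N := by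
      rw [← hsum, mul_comm, ← smul_eq_mul, ← sum_const, ← sum_add_distrib]
      exact sum_congr rfl fun a ha => Nat.sub_add_cancel (h2 a ha)
    omega
  have hbN : #(univ.image s) ≤ N := by rw [hN, ← card_univ]; exact card_image_le
  rw [integral_prod_word_eq hX hm, ← prod_subset (subset_univ (univ.image s)) (fun a _ ha => by
    have : #{f | s f = a} = 0 := by
      rw [card_eq_zero, filter_eq_empty_iff]
      rintro f - rfl
      exact ha (mem_image_of_mem s (mem_univ f))
    simp [this]), abs_prod]
  calc ∏ a ∈ univ.image s, |∫ ω, X a ω ^ #{f | s f = a} ∂P|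
      ≤ ∏ a ∈ univ.image s, (K ^ #{f | s f = a} * (2 * B * (N : ℝ) ^ (#{f | s f = a} - 2))) := by
        refine prod_le_prod (fun a _ => abs_nonneg _) fun a ha => (hmom a _).trans ?_
        refine mul_le_mul_of_nonneg_left ?_ (pow_nonneg hK _)
        obtain ⟨q, hq⟩ := Nat.exists_eq_add_of_le (h2 a ha)
        have hq' : #{f | s f = a} = q + 2 := by omega
        rw [hq', Nat.add_sub_cancel]
        have hle : q + 2 ≤ N := by rw [← hq']; exact card_le_univ _
        have hf : ((q + 2).factorial : ℝ) ≤ 2 * (N : ℝ) ^ q := by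
          exact_mod_cast factorial_le_two_mul_pow q hle
        nlinarith
    _ = K ^ N * ((2 * B) ^ #(univ.image s) * (N : ℝ) ^ (N - 2 * #(univ.image s))) := by
        rw [prod_mul_distrib, prod_mul_distrib, prod_pow_eq_pow_sum, prod_pow_eq_pow_sum, hsum,
          hexc, prod_const]
    _ ≤ K ^ N * ((2 * B) ^ N * (N : ℝ) ^ (N - 2 * #(univ.image s))) := by
        gcongr
        linarith
    _ = _ := by rw [mul_pow]; ring

end Moments

section TensorMoments

open MeasureTheory ProbabilityTheory

variable {κ n : ℕ}

/-- The multi-index of an entry: the slice, followed by the row and the column. -/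
def Entry.index (e : Entry κ n) : Fin (2 * κ + 1) → Fin n :=
  (Fin.cons e.1 (Fin.append e.2.1 e.2.2) : Fin (κ + κ + 1) → Fin n) ∘ Fin.cast (by omega)

theorem Entry.index_injective : Function.Injective (Entry.index (κ := κ) (n := n)) := by
  intro e e' h
  have h1 : (Fin.cons e.1 (Fin.append e.2.1 e.2.2) : Fin (κ + κ + 1) → Fin n)
      = Fin.cons e'.1 (Fin.append e'.2.1 e'.2.2) := by
    funext x
    have := congrFun h (Fin.cast (by omega) x)
    simpa [Entry.index] using this
  obtain ⟨h2, h3⟩ := Fin.cons_inj.1 h1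
  refine Prod.ext h2 (Prod.ext ?_ ?_)
  · funext x
    simpa using congrFun h3 (Fin.castAdd κ x)
  · funext x
    simpa only [Fin.append_right] using congrFun h3 (Fin.natAdd κ x)

/-- The number of distinct rearrangements of a multi-index. -/
noncomputable def numRearr {k : ℕ} (S : Fin k → Fin n) : ℕ :=
  #(univ.image fun π : Equiv.Perm (Fin k) => S ∘ π)

theorem numRearr_le {k : ℕ} (S : Fin k → Fin n) : numRearr S ≤ k.factorial := by
  refine card_image_le.trans ?_
  rw [card_univ, Fintype.card_perm, Fintype.card_fin]

theorem asymmetrize_of_isSymmetric {k : ℕ} {T : Tensor k n} (hT : IsSymmetric T)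
    (S : Fin k → Fin n) [Decidable (Monotone S)] :
    asymmetrize T S = if Monotone S then numRearr S * T S else 0 := by
  unfold asymmetrize
  split_ifs with h
  · rw [numRearr, ← nsmul_eq_mul, ← sum_const]
    refine sum_congr (by congr!) fun R hR => ?_
    obtain ⟨π, -, rfl⟩ := mem_image.1 hR
    exact hT π S
  · rfl

theorem entryVal_eq (T : Tensor (2 * κ + 1) n) (e : Entry κ n) :
    entryVal T e = asymmetrize T e.index := rfl

variable {Ω : Type*} [MeasurableSpace Ω] {P : Measure Ω}
  {v : ℝ≥0} {A : Ω → Tensor (2 * κ + 1) n}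

theorem memLp_entryVal (hA : IsRandomTensor P v A) (e : Entry κ n) (p : ℝ≥0) :
    MemLp (fun ω => entryVal (A ω) e) p P := by
  classical
  simp only [entryVal_eq, asymmetrize_of_isSymmetric (hA.symmetric _)]
  split_ifs
  · exact ((hA.subgaussian _).memLp p).const_mul _
  · exact MemLp.zero'

theorem integrable_prod_entryVal [IsProbabilityMeasure P] (hA : IsRandomTensor P v A)
    {F : Type*} [Fintype F] (e : F → Entry κ n) :
    Integrable (fun ω => ∏ f, entryVal (A ω) (e f)) P := by
  rcases isEmpty_or_nonempty F with hF | hF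
  · simp
  have h := MemLp.prod' (s := univ) (p := fun _ : F => ((Fintype.card F : ℝ≥0) : ENNReal))
    fun f _ => memLp_entryVal hA (e f) (Fintype.card F : ℝ≥0)
  rw [← memLp_one_iff_integrable]
  convert h using 1
  have hne : (Fintype.card F : ENNReal) ≠ 0 := by exact_mod_cast Fintype.card_ne_zero
  simp only [sum_const, card_univ, nsmul_eq_mul, ENNReal.coe_natCast]
  rw [ENNReal.mul_inv_cancel hne (ENNReal.natCast_ne_top _), inv_one]

/-- The monomials of the asymmetrized tensor: either some factor vanishes identically, or the
monomial is one in independent centered subgaussian variables. -/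
theorem entryVal_word_dichotomy (hA : IsRandomTensor P v A) {F : Type*} [Fintype F]
    (e : F → Entry κ n) :
    (∀ ω, ∃ f, entryVal (A ω) (e f) = 0) ∨
    ∃ s : F → {S : Fin (2 * κ + 1) → Fin n // Monotone S},
      (∀ f, (s f).1 = (e f).index) ∧
      ∀ ω f, entryVal (A ω) (e f) = numRearr (s f).1 * A ω (s f).1 := by
  classical
  by_cases h : ∀ f, Monotone (e f).index
  · refine Or.inr ⟨fun f => ⟨(e f).index, h f⟩, fun f => rfl, fun ω f => ?_⟩
    rw [entryVal_eq, asymmetrize_of_isSymmetric (hA.symmetric _), if_pos (h f)]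
  · push Not at h
    obtain ⟨f, hf⟩ := h
    refine Or.inl fun ω => ⟨f, ?_⟩
    rw [entryVal_eq, asymmetrize_of_isSymmetric (hA.symmetric _), if_neg hf]

theorem scaled_entries [IsProbabilityMeasure P] (hA : IsRandomTensor P v A) :
    iIndepFun (fun (S : {S : Fin (2 * κ + 1) → Fin n // Monotone S}) (ω : Ω) =>
      (numRearr S.1 : ℝ) * A ω S.1) P ∧
    (∀ S : {S : Fin (2 * κ + 1) → Fin n // Monotone S},
      AEMeasurable (fun ω => (numRearr S.1 : ℝ) * A ω S.1) P) ∧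
    (∀ S : {S : Fin (2 * κ + 1) → Fin n // Monotone S},
      ∫ ω, (numRearr S.1 : ℝ) * A ω S.1 ∂P = 0) ∧
    ∀ (S : {S : Fin (2 * κ + 1) → Fin n // Monotone S}) (p : ℕ),
      |∫ ω, ((numRearr S.1 : ℝ) * A ω S.1) ^ p ∂P|
        ≤ ((2 * κ + 1).factorial : ℝ) ^ p * (2 * Real.exp (v / 2) * p.factorial) := by
  refine ⟨hA.indep.comp (fun S x => (numRearr S.1 : ℝ) * x) fun S => measurable_const_mul _,
    fun S => (hA.subgaussian S.1).aemeasurable.const_mul _, fun S => ?_, fun S p => ?_⟩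
  · rw [integral_const_mul, integral_eq_zero_of_subgaussian (hA.subgaussian S.1), mul_zero]
  · simp only [mul_pow]
    rw [integral_const_mul, abs_mul, abs_of_nonneg (by positivity)]
    have h1 := abs_integral_pow_le_of_subgaussian (hA.subgaussian S.1) p
    have h2 : (numRearr S.1 : ℝ) ≤ (2 * κ + 1).factorial := by exact_mod_cast numRearr_le S.1
    gcongr

/-- The constant, for each factor, in the moment bound: `k!` for the rearrangements, and the rest
for the subgaussian moments. -/
noncomputable def momentConst (κ : ℕ) (v : ℝ≥0) : ℝ :=
  (2 * κ + 1).factorial * (2 * (2 * Real.exp (v / 2)))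

/-- A word with an unrepeated entry has expectation zero, either by independence or because the
asymmetrized tensor vanishes at one of its entries. -/
theorem integral_entryVal_word_nonpos [IsProbabilityMeasure P] (hA : IsRandomTensor P v A)
    {F : Type*} [Fintype F] (e : F → Entry κ n) (he : ∃ f, ∀ g, g ≠ f → e g ≠ e f) :
    ∫ ω, ∏ f, entryVal (A ω) (e f) ∂P ≤ 0 := by
  classical
  rcases entryVal_word_dichotomy hA e with h | ⟨s, hs, hval⟩
  · have : ∀ ω, ∏ f, entryVal (A ω) (e f) = 0 := fun ω => by
      obtain ⟨f, hf⟩ := h ω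
      exact prod_eq_zero (mem_univ f) hf
    simp [this]
  · obtain ⟨hi, hm, h0, -⟩ := scaled_entries hA
    simp only [hval]
    refine (integral_prod_word_eq_zero hi hm h0 s ?_).le
    obtain ⟨f, hf⟩ := he
    refine ⟨f, fun g hg h => hf g hg (Entry.index_injective ?_)⟩
    rw [← hs, ← hs, h]

theorem integral_entryVal_word_le [IsProbabilityMeasure P] (hA : IsRandomTensor P v A)
    {F : Type*} [Fintype F] (e : F → Entry κ n) (he : ∀ f, ∃ g, g ≠ f ∧ e g = e f) :
    ∫ ω, ∏ f, entryVal (A ω) (e f) ∂P ≤ momentConst κ v ^ Fintype.card F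
      * (Fintype.card F : ℝ) ^ (Fintype.card F - 2 * #(univ.image e)) := by
  classical
  rcases entryVal_word_dichotomy hA e with h | ⟨s, hs, hval⟩
  · have : ∀ ω, ∏ f, entryVal (A ω) (e f) = 0 := fun ω => by
      obtain ⟨f, hf⟩ := h ω
      exact prod_eq_zero (mem_univ f) hf
    simp only [this, integral_zero]
    unfold momentConst
    positivity
  · obtain ⟨hi, hm, -, hmom⟩ := scaled_entries hA
    simp only [hval]
    have hB : (1 : ℝ) ≤ 2 * Real.exp (v / 2) := by
      have : (1 : ℝ) ≤ Real.exp (v / 2) := Real.one_le_exp (by positivity)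
      linarith
    have hcard : #(univ.image s) = #(univ.image e) := by
      rw [← card_image_of_injective (univ.image s) Subtype.val_injective,
        ← card_image_of_injective (univ.image e) Entry.index_injective, image_image, image_image]
      congr 2
      funext f
      exact hs f
    refine (le_abs_self _).trans ((abs_integral_prod_word_le hi hm (Nat.cast_nonneg _) hB hmom s
      fun f => ?_).trans_eq ?_)
    · obtain ⟨g, hg, h⟩ := he f
      exact ⟨g, hg, Subtype.ext (by rw [hs, hs, h])⟩
    · rw [hcard]; rfl

end TensorMoments

/-! ### The spectral norm of a random certificate matrix -/

section ExpectedTrace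

open Matrix MeasureTheory

variable {κ n : ℕ} {Ω : Type*} [MeasurableSpace Ω] {P : Measure Ω} {v : ℝ≥0}
  {A : Ω → Tensor (2 * κ + 1) n}

/-- The expected trace of the power, by the sum over all words applied to the positive parts of
their expectations. The condition that the walk is closed is given up. -/
theorem integral_trace_le [IsProbabilityMeasure P] (hA : IsRandomTensor P v A) (hκ : 1 ≤ κ)
    {d ℓ L : ℕ} (hd : 1 ≤ d) (hL : L = 2 * (ℓ + 1))
    (hn : (2 * κ * (L * d)) ^ 4 ≤ n) (hn' : 2 * κ * d + κ * (L * d) ≤ n)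
    (hn'' : (L * d) ^ 13 ≤ n) :
    Integrable (fun ω => ((certMatrix d (A ω) * (certMatrix d (A ω))ᵀ) ^ (ℓ + 1)).trace) P ∧
    ∫ ω, ((certMatrix d (A ω) * (certMatrix d (A ω))ᵀ) ^ (ℓ + 1)).trace ∂P
      ≤ momentConst κ v ^ (2 * (L * d)) * ((2 * n : ℝ) ^ (2 * κ * d)
            * ((2 * Real.exp 1 * n) / (κ * d)) ^ (κ * (L * d)))
          * ((32 * Real.exp 1) ^ (L * d) * ((n : ℝ) * (L * d : ℕ)) ^ ((ℓ + 1) * d)) := by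
  classical
  subst hL
  set L := 2 * (ℓ + 1) with hL
  set c := (Fintype.card (Equiv.Perm (Pos κ d)) : ℝ) ^ L with hc
  have hc0 : 0 < c := pow_pos (by exact_mod_cast Fintype.card_pos) _
  have hint : ∀ (π : Fin L → Equiv.Perm (Pos κ d)) (V : Fin (L + 1) → Pos κ d → Fin n)
      (i : Fin L × Fin d → Fin n), Integrable (fun ω =>
        if ∀ t j, word π V i (t, j, 0) ≠ word π V i (t, j, 1) then
          ∏ f, entryVal (A ω) (word π V i f) else 0) P := fun π V i => by
    split_ifs
    · exact integrable_prod_entryVal hA _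
    · exact integrable_zero _ _ _
  have hint' : ∀ (π : Fin L → Equiv.Perm (Pos κ d)) (V : Fin (L + 1) → Pos κ d → Fin n),
      Integrable (fun ω => if V 0 = V (Fin.last _) then
        ∑ i : Fin L × Fin d → Fin n,
          if ∀ t j, word π V i (t, j, 0) ≠ word π V i (t, j, 1) then
            ∏ f, entryVal (A ω) (word π V i f) else 0 else 0) P := fun π V => by
    split_ifs
    · exact integrable_finsetSum _ fun i _ => hint π V i
    · exact integrable_zero _ _ _
  simp only [trace_expansion]
  refine ⟨(integrable_finsetSum _ fun π _ => integrable_finsetSum _ fun V _ =>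
    hint' π V).const_mul _, ?_⟩
  rw [integral_const_mul, integral_finsetSum _ fun π _ => integrable_finsetSum _ fun V _ =>
    hint' π V, inv_mul_le_iff₀ hc0]
  -- the positive part, so that words with `V 0 ≠ V (Fin.last _)` may be added
  set M : (Factor L d → Entry κ n) → ℝ := fun e => max (∫ ω, ∏ f, entryVal (A ω) (e f) ∂P) 0
    with hM
  have hcard : Fintype.card (Factor L d) = 2 * (L * d) := card_factor
  have hmc : 0 ≤ momentConst κ v := by unfold momentConst; positivity
  refine le_trans ?_ (sum_word_weight_le hκ hd hL (Nat.succ_pos ℓ) hn hn' hn'' hmc M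
    (fun e he => max_le (integral_entryVal_word_nonpos hA e he) le_rfl)
    fun e he => max_le ?_ (by positivity))
  · refine sum_le_sum fun π _ => ?_
    rw [integral_finsetSum _ fun V _ => hint' π V]
    refine sum_le_sum fun V _ => ?_
    have hnn : ∀ i : Fin L × Fin d → Fin n,
        0 ≤ if ∀ t j, word π V i (t, j, 0) ≠ word π V i (t, j, 1) then M (word π V i) else 0 :=
      fun i => by
        split_ifs
        · exact le_max_right _ _
        · exact le_rfl
    by_cases hV : V 0 = V (Fin.last _)
    · simp only [if_pos hV]
      rw [integral_finsetSum _ fun i _ => hint π V i]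
      refine sum_le_sum fun i _ => ?_
      split_ifs
      · exact le_max_left _ _
      · simp
    · simp only [if_neg hV, integral_zero]
      exact sum_nonneg fun i _ => hnn i
  · have h := integral_entryVal_word_le hA e he
    rw [hcard] at h
    exact_mod_cast h

/-- The constant in the bound on the squared spectral norm. The factor `2` is what makes the
failure probability exponentially small in `L`. -/
noncomputable def normConst (κ : ℕ) (v : ℝ≥0) : ℝ :=
  (2 * (momentConst κ v ^ 2 * Real.exp 1 ^ (4 * κ) * (2 * Real.exp 1) ^ κ * (32 * Real.exp 1))) ^ 2

/-- The bound on the expected trace in the form of a power. -/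
theorem trace_bound_le {d ℓ L : ℕ} (hκ : 1 ≤ κ) (hd : 1 ≤ d) (hL : L = 2 * (ℓ + 1))
    (hn0 : 1 ≤ n) (hlog : (2 * n : ℝ) ≤ Real.exp (2 * L)) :
    momentConst κ v ^ (2 * (L * d)) * ((2 * n : ℝ) ^ (2 * κ * d)
            * ((2 * Real.exp 1 * n) / (κ * d)) ^ (κ * (L * d)))
          * ((32 * Real.exp 1) ^ (L * d) * ((n : ℝ) * (L * d : ℕ)) ^ ((ℓ + 1) * d))
      ≤ (1 / 2) ^ L * (normConst κ v * (L * (n : ℝ) ^ (2 * κ + 1) / (d : ℝ) ^ (2 * κ - 1)))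
          ^ ((ℓ + 1) * d) := by
  have hmc : 0 ≤ momentConst κ v := by unfold momentConst; positivity
  have hd' : (1 : ℝ) ≤ d := by exact_mod_cast hd
  have hκ' : (1 : ℝ) ≤ κ := by exact_mod_cast hκ
  set Q := (ℓ + 1) * d with hQ
  have hLd : L * d = 2 * Q := by rw [hL, hQ]; ring
  -- the cost of the labels of `V 0`, absorbed since `L` is at least of the order of `log n`
  have h1 : (2 * n : ℝ) ^ (2 * κ * d) ≤ Real.exp 1 ^ (4 * κ * (L * d)) := by
    calc (2 * n : ℝ) ^ (2 * κ * d) ≤ Real.exp (2 * L) ^ (2 * κ * d) := by gcongr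
      _ = _ := by
        rw [← Real.exp_nat_mul, ← Real.exp_nat_mul]
        congr 1
        push_cast
        ring
  have h2 : ((2 * Real.exp 1 * n) / (κ * d)) ^ (κ * (L * d))
      ≤ (2 * Real.exp 1) ^ (κ * (L * d)) * ((n : ℝ) ^ (2 * κ) / (d : ℝ) ^ (2 * κ)) ^ Q := by
    calc ((2 * Real.exp 1 * n) / (κ * d)) ^ (κ * (L * d))
        ≤ ((2 * Real.exp 1 * n) / (1 * d)) ^ (κ * (L * d)) := by gcongr
      _ = _ := by
        rw [one_mul, mul_div_assoc, mul_pow, ← div_pow (n : ℝ), ← pow_mul, hLd]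
        congr 2
        ring
  have h3 : ((n : ℝ) ^ (2 * κ) / (d : ℝ) ^ (2 * κ)) ^ Q * ((n : ℝ) * (L * d : ℕ)) ^ Q
      = (L * (n : ℝ) ^ (2 * κ + 1) / (d : ℝ) ^ (2 * κ - 1)) ^ Q := by
    rw [← mul_pow]
    congr 1
    obtain ⟨k, hk⟩ : ∃ k, 2 * κ = k + 1 := ⟨2 * κ - 1, by omega⟩
    rw [hk, Nat.add_sub_cancel]
    have : (d : ℝ) ≠ 0 := by positivity
    push_cast
    field_simp
    ring
  set R := L * (n : ℝ) ^ (2 * κ + 1) / (d : ℝ) ^ (2 * κ - 1) with hR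
  have hR0 : 0 ≤ R := by positivity
  set a := momentConst κ v ^ 2 * Real.exp 1 ^ (4 * κ) * (2 * Real.exp 1) ^ κ * (32 * Real.exp 1)
    with ha
  have ha0 : 0 ≤ a := by positivity
  calc _ ≤ momentConst κ v ^ (2 * (L * d)) * (Real.exp 1 ^ (4 * κ * (L * d))
            * ((2 * Real.exp 1) ^ (κ * (L * d)) * ((n : ℝ) ^ (2 * κ) / (d : ℝ) ^ (2 * κ)) ^ Q))
          * ((32 * Real.exp 1) ^ (L * d) * ((n : ℝ) * (L * d : ℕ)) ^ Q) := by
        gcongr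
    _ = a ^ (L * d) * (((n : ℝ) ^ (2 * κ) / (d : ℝ) ^ (2 * κ)) ^ Q
          * ((n : ℝ) * (L * d : ℕ)) ^ Q) := by
        rw [ha]
        simp only [mul_pow _ _ (L * d), ← pow_mul]
        ring
    _ = (1 / 2) ^ (L * d) * (normConst κ v * R) ^ Q := by
        rw [h3, mul_pow _ R, normConst, ← ha, ← pow_mul, ← hLd, mul_pow 2 a, ← mul_assoc,
          ← mul_assoc, ← mul_pow]
        norm_num
    _ ≤ (1 / 2) ^ L * (normConst κ v * R) ^ Q := by
        have : 0 ≤ normConst κ v := by unfold normConst; positivity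
        refine mul_le_mul_of_nonneg_right ?_ (by positivity)
        exact pow_le_pow_of_le_one (by norm_num) (by norm_num) (Nat.le_mul_of_pos_right _ hd)

/-- The spectral norm of the certificate matrix is small with probability at least `1 - 2 ^ (-L)`,
where `L` is a power of two of the order of `log n`. -/
theorem measure_specNorm_gt_le [IsProbabilityMeasure P] (hA : IsRandomTensor P v A) (hκ : 1 ≤ κ)
    {d s L : ℕ} (hd : 1 ≤ d) (hL : L = 2 * 2 ^ (s + 1))
    (hn : (2 * κ * (L * d)) ^ 13 ≤ n) (hlog : (2 * n : ℝ) ≤ Real.exp (2 * L)) :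
    P {ω | ¬ specNorm (certMatrix d (A ω)) ^ 2
        ≤ (normConst κ v * (L * (n : ℝ) ^ (2 * κ + 1) / (d : ℝ) ^ (2 * κ - 1))) ^ d}
      ≤ ENNReal.ofReal ((1 / 2) ^ L) := by
  obtain ⟨ℓ, hℓ⟩ : ∃ ℓ, 2 ^ (s + 1) = ℓ + 1 := ⟨2 ^ (s + 1) - 1, by
    have := Nat.one_le_two_pow (n := s + 1); omega⟩
  rw [hℓ] at hL
  have hL2 : 2 ≤ L := by omega
  have hLd : 1 ≤ L * d := Nat.mul_pos (by omega) hd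
  have hX1 : 1 ≤ 2 * κ * (L * d) := Nat.mul_pos (Nat.mul_pos two_pos hκ) hLd
  have hle : L * d ≤ 2 * κ * (L * d) := Nat.le_mul_of_pos_left _ (Nat.mul_pos two_pos hκ)
  have hn1 : 2 * κ * (L * d) ≤ n := (Nat.le_self_pow (by norm_num) _).trans hn
  obtain ⟨hint, hbd⟩ := integral_trace_le hA hκ hd hL
    ((Nat.pow_le_pow_right hX1 (by norm_num)).trans hn)
    (le_trans (by nlinarith [Nat.mul_le_mul_left (κ * d) hL2]) hn1)
    ((Nat.pow_le_pow_left hle 13).trans hn)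
  set R := normConst κ v * (L * (n : ℝ) ^ (2 * κ + 1) / (d : ℝ) ^ (2 * κ - 1)) with hR
  have hn0 : 1 ≤ n := hX1.trans hn1
  have hnc : 0 < normConst κ v := by unfold normConst momentConst; positivity
  have hR0 : 0 < R := by
    have : (0 : ℝ) < n := by exact_mod_cast hn0
    have : (0 : ℝ) < d := by exact_mod_cast hd
    have : (0 : ℝ) < L := by exact_mod_cast (by omega : 0 < L)
    positivity
  have htr : ∀ ω, specNorm (certMatrix d (A ω)) ^ (2 * (ℓ + 1))
      ≤ ((certMatrix d (A ω) * (certMatrix d (A ω))ᵀ) ^ (ℓ + 1)).trace := fun ω => by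
    rw [← hℓ]
    exact specNorm_pow_le_trace _ s
  set tr : Ω → ℝ := fun ω => ((certMatrix d (A ω) * (certMatrix d (A ω))ᵀ) ^ (ℓ + 1)).trace
    with htrdef
  have hnorm0 : ∀ ω, 0 ≤ specNorm (certMatrix d (A ω)) := fun ω => norm_nonneg _
  have htr0 : ∀ ω, 0 ≤ tr ω := fun ω => (pow_nonneg (hnorm0 ω) _).trans (htr ω)
  have hsub : {ω | ¬ specNorm (certMatrix d (A ω)) ^ 2 ≤ R ^ d}
      ⊆ {ω | R ^ ((ℓ + 1) * d) ≤ tr ω} := fun ω hω => by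
    have hω' : R ^ d < specNorm (certMatrix d (A ω)) ^ 2 := not_le.1 hω
    refine le_trans ?_ (htr ω)
    rw [mul_comm (ℓ + 1), pow_mul, pow_mul]
    exact pow_le_pow_left₀ (by positivity) hω'.le _
  refine (measure_mono hsub).trans ?_
  have hmarkov := mul_meas_ge_le_integral_of_nonneg (Filter.Eventually.of_forall htr0) hint
    (R ^ ((ℓ + 1) * d))
  have hfin : P.real {ω | R ^ ((ℓ + 1) * d) ≤ tr ω} ≤ (1 / 2) ^ L := by
    have hpos : 0 < R ^ ((ℓ + 1) * d) := by positivity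
    have h := hmarkov.trans (hbd.trans (trace_bound_le hκ hd hL hn0 hlog))
    rw [mul_comm] at h
    exact le_of_mul_le_mul_right h hpos
  rw [← ofReal_measureReal]
  exact ENNReal.ofReal_le_ofReal hfin

end ExpectedTrace

/-! ### The certificate bounds the injective norm -/

section Deterministic

open Matrix

variable {κ n : ℕ}

/-- Every multi-index has exactly one nondecreasing rearrangement, the sorted one. -/
theorem monotone_and_mem_rearr_iff {k : ℕ} (S R : Fin k → Fin n) :
    (Monotone S ∧ R ∈ univ.image fun π : Equiv.Perm (Fin k) => S ∘ π) ↔ R ∘ Tuple.sort R = S := by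
  constructor
  · rintro ⟨hS, hR⟩
    obtain ⟨π, -, rfl⟩ := mem_image.1 hR
    have h : (S ∘ ⇑π) ∘ ⇑π⁻¹ = S := by ext x; simp
    calc (S ∘ π) ∘ Tuple.sort (S ∘ π) = (S ∘ π) ∘ ⇑π⁻¹ :=
          Tuple.unique_monotone (Tuple.monotone_sort _) (by rwa [h])
      _ = S := h
  · rintro rfl
    refine ⟨Tuple.monotone_sort R, mem_image.2 ⟨(Tuple.sort R)⁻¹, mem_univ _, ?_⟩⟩
    ext x
    simp

theorem evalPow_eq_asymmetrize {k : ℕ} (T : Tensor k n) (x : EuclideanSpace ℝ (Fin n)) :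
    evalPow T x = evalPow (asymmetrize T) x := by
  classical
  have hinv : ∀ (S : Fin k → Fin n), ∀ R ∈ univ.image fun π : Equiv.Perm (Fin k) => S ∘ π,
      ∏ j, x (R j) = ∏ j, x (S j) := by
    intro S R hR
    obtain ⟨π, -, rfl⟩ := mem_image.1 hR
    exact Equiv.prod_comp π fun j => x (S j)
  have h1 : ∀ S : Fin k → Fin n, asymmetrize T S * ∏ j, x (S j)
      = ∑ R, if R ∘ Tuple.sort R = S then T R * ∏ j, x (R j) else 0 := by
    intro S
    simp only [← monotone_and_mem_rearr_iff, ite_and]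
    unfold asymmetrize
    by_cases hS : Monotone S
    · simp only [if_pos hS, sum_mul, ← sum_filter, filter_mem_eq_inter, univ_inter]
      refine sum_congr (by congr!) fun R hR => ?_
      rw [hinv S R (by convert hR)]
    · simp [hS]
  unfold evalPow
  simp only [h1]
  rw [sum_comm]
  simp

theorem Entry.index_bijective : Function.Bijective (Entry.index (κ := κ) (n := n)) := by
  rw [Fintype.bijective_iff_injective_and_card]
  refine ⟨Entry.index_injective, ?_⟩
  simp only [Entry, Fintype.card_prod, Fintype.card_fun, Fintype.card_fin]
  ring

theorem prod_index (e : Entry κ n) (x : Fin n → ℝ) :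
    ∏ j, x (e.index j) = x e.1 * ((∏ s, x (e.2.1 s)) * ∏ s, x (e.2.2 s)) := by
  have h : 2 * κ + 1 = κ + κ + 1 := by omega
  rw [← Equiv.prod_comp (finCongr h.symm), Fin.prod_univ_succ, Fin.prod_univ_add]
  congr 1
  refine congrArg₂ _ (prod_congr rfl fun s _ => ?_) (prod_congr rfl fun s _ => ?_)
  · have : e.index ((finCongr h.symm) (Fin.castAdd κ s).succ)
        = (Fin.cons e.1 (Fin.append e.2.1 e.2.2) : Fin (κ + κ + 1) → Fin n)
          (Fin.castAdd κ s).succ := rfl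
    rw [this, Fin.cons_succ, Fin.append_left]
  · have : e.index ((finCongr h.symm) (Fin.natAdd κ s).succ)
        = (Fin.cons e.1 (Fin.append e.2.1 e.2.2) : Fin (κ + κ + 1) → Fin n)
          (Fin.natAdd κ s).succ := rfl
    rw [this, Fin.cons_succ, Fin.append_right]

/-- The multi-indices of a row of the tensor power, in terms of the blocks of the tensor factors.
-/
def blockEquiv (κ d n : ℕ) :
    (Pos κ d → Fin n) ≃ (Fin d → (Fin κ → Fin n) × (Fin κ → Fin n)) where
  toFun := block
  invFun B p := if p.2.1 = 0 then (B p.1).1 p.2.2 else (B p.1).2 p.2.2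
  left_inv U := by
    funext ⟨j, h, s⟩
    fin_cases h <;> simp [block]
  right_inv B := by
    funext j
    simp [block]

/-- The coordinates of a tensor power of a vector. -/
def powVec {P : Type*} [Fintype P] (x : Fin n → ℝ) (U : P → Fin n) : ℝ := ∏ p, x (U p)

theorem sum_powVec_sq {P : Type*} [Fintype P] [DecidableEq P] {x : Fin n → ℝ}
    (hx : ∑ i, x i ^ 2 = 1) : ∑ U : P → Fin n, powVec x U ^ 2 = 1 := by
  simp only [powVec, ← prod_pow]
  rw [← Fintype.piFinset_univ, ← prod_univ_sum (fun _ : P => univ) fun _ i => x i ^ 2]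
  simp [hx]

theorem powVec_comp {P : Type*} [Fintype P] (x : Fin n → ℝ) (π : Equiv.Perm P) (U : P → Fin n) :
    powVec x (U ∘ π) = powVec x U :=
  Equiv.prod_comp π fun p => x (U p)

/-- The quadratic form at a tensor power of a vector does not notice the symmetrization. -/
theorem quadForm_symmetrize {P : Type} [Fintype P] [DecidableEq P] (x : Fin n → ℝ)
    (W : Matrix (P → Fin n) (P → Fin n) ℝ) :
    ∑ U, ∑ V, symmetrize W U V * (powVec x U * powVec x V)
      = ∑ U, ∑ V, W U V * (powVec x U * powVec x V) := by
  have hπσ : ∀ π σ : Equiv.Perm P,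
      ∑ U, ∑ V, W (U ∘ π) (V ∘ σ) * (powVec x U * powVec x V)
        = ∑ U, ∑ V, W U V * (powVec x U * powVec x V) := by
    intro π σ
    refine Fintype.sum_equiv (Equiv.arrowCongr π.symm (Equiv.refl (Fin n))) _ _ fun U => ?_
    refine Fintype.sum_equiv (Equiv.arrowCongr σ.symm (Equiv.refl (Fin n))) _ _ fun V => ?_
    rw [← powVec_comp x π U, ← powVec_comp x σ V]
    rfl
  have hc : (Fintype.card (Equiv.Perm P) : ℝ) ≠ 0 := by exact_mod_cast Fintype.card_ne_zero
  calc _ = ((Fintype.card (Equiv.Perm P) : ℝ) ^ 2)⁻¹ * ∑ π : Equiv.Perm P, ∑ σ : Equiv.Perm P,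
        ∑ U, ∑ V, W (U ∘ π) (V ∘ σ) * (powVec x U * powVec x V) := by
        simp only [symmetrize, Matrix.smul_apply, Matrix.sum_apply, submatrix_apply, smul_eq_mul,
          mul_assoc, ← mul_sum, sum_mul]
        congr 1
        rw [sum_congr rfl fun U _ => sum_comm, sum_comm]
        refine sum_congr rfl fun π _ => ?_
        rw [sum_congr rfl fun U _ => sum_comm, sum_comm]
    _ = _ := by
        simp only [hπσ, sum_const, card_univ, nsmul_eq_mul]
        field_simp

theorem quadForm_tensorPow {d : ℕ} (x : Fin n → ℝ)
    (N : Matrix ((Fin κ → Fin n) × (Fin κ → Fin n)) ((Fin κ → Fin n) × (Fin κ → Fin n)) ℝ) :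
    ∑ U, ∑ V, tensorPow d N U V * (powVec x U * powVec x V)
      = (∑ I, ∑ J, N I J
          * ((powVec x I.1 * powVec x I.2) * (powVec x J.1 * powVec x J.2))) ^ d := by
  have hw : ∀ U : Pos κ d → Fin n,
      powVec x U = ∏ j, (powVec x (block U j).1 * powVec x (block U j).2) := by
    intro U
    simp only [powVec, block]
    rw [Fintype.prod_prod_type]
    refine prod_congr rfl fun j _ => ?_
    rw [Fintype.prod_prod_type, Fin.prod_univ_two]
  simp only [tensorPow, of_apply, hw, ← prod_mul_distrib]
  rw [← Fintype.sum_prod_type', ← Fintype.sum_prod_type' (f := fun I J => N I J *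
    ((powVec x I.1 * powVec x I.2) * (powVec x J.1 * powVec x J.2)))]
  rw [← Fin.prod_const d, prod_univ_sum, Fintype.piFinset_univ]
  refine Fintype.sum_equiv (((blockEquiv κ d n).prodCongr (blockEquiv κ d n)).trans
    (Equiv.arrowProdEquivProdArrow _ _ _).symm) _ _ fun UV => ?_
  rfl

theorem quadForm_le_specNorm {ι : Type} [Fintype ι] [DecidableEq ι] (C : Matrix ι ι ℝ)
    (w : ι → ℝ) (hw : ∑ u, w u ^ 2 = 1) :
    ∑ u, ∑ v, C u v * (w u * w v) ≤ specNorm C := by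
  set y : EuclideanSpace ℝ ι := WithLp.toLp 2 w with hy
  have hnorm : ‖y‖ = 1 := by
    rw [EuclideanSpace.norm_eq]
    simp [hy, hw]
  have h1 : inner ℝ y (toEuclideanCLM (n := ι) (𝕜 := ℝ) C y)
      = ∑ u, ∑ v, C u v * (w u * w v) := by
    rw [inner_toEuclideanCLM]
    simp only [dotProduct, mulVec, hy, mul_sum]
    exact sum_congr rfl fun u _ => sum_congr rfl fun v _ => by ring
  rw [← h1]
  calc _ ≤ ‖y‖ * ‖toEuclideanCLM (n := ι) (𝕜 := ℝ) C y‖ := real_inner_le_norm _ _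
    _ ≤ ‖y‖ * (‖toEuclideanCLM (n := ι) (𝕜 := ℝ) C‖ * ‖y‖) := by
        gcongr; exact ContinuousLinearMap.le_opNorm _ _
    _ = specNorm C := by rw [hnorm, one_mul, mul_one]; rfl

theorem evalPow_eq_sum_slices (T : Tensor (2 * κ + 1) n) (x : EuclideanSpace ℝ (Fin n)) :
    evalPow T x = ∑ i, x i * ∑ I, ∑ J, entryVal T (i, I, J) * (powVec x I * powVec x J) := by
  rw [evalPow_eq_asymmetrize, evalPow, ← Entry.index_bijective.sum_comp, Fintype.sum_prod_type]
  refine sum_congr rfl fun i _ => ?_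
  rw [Fintype.sum_prod_type, mul_sum]
  refine sum_congr rfl fun I _ => ?_
  rw [mul_sum]
  refine sum_congr rfl fun J _ => ?_
  rw [prod_index _ fun i => x i, entryVal_eq]
  simp only [powVec]
  ring

/-- The quadratic form of `∑ i, A_i ⊗ A_i` splits into that of its diagonal-free part and a
nonnegative combination of the numbers `∑ i, A_i(a,b)²`. -/
theorem sum_sq_quadForm (T : Tensor (2 * κ + 1) n) (x : Fin n → ℝ) :
    ∑ i, (∑ I, ∑ J, entryVal T (i, I, J) * (powVec x I * powVec x J)) ^ 2
      = (∑ I, ∑ J, diagFree T I J *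
          ((powVec x I.1 * powVec x I.2) * (powVec x J.1 * powVec x J.2)))
        + ∑ I, ∑ J, (∑ i, entryVal T (i, I, J) ^ 2) * (powVec x I ^ 2 * powVec x J ^ 2) := by
  set g : (Fin κ → Fin n) → (Fin κ → Fin n) → (Fin κ → Fin n) → (Fin κ → Fin n) → ℝ :=
    fun I₁ I₂ J₁ J₂ => (∑ i, entryVal T (i, I₁, J₁) * entryVal T (i, I₂, J₂)) *
      ((powVec x I₁ * powVec x I₂) * (powVec x J₁ * powVec x J₂)) with hg
  have h1 : ∑ i, (∑ I, ∑ J, entryVal T (i, I, J) * (powVec x I * powVec x J)) ^ 2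
      = ∑ I₁, ∑ I₂, ∑ J₁, ∑ J₂, g I₁ I₂ J₁ J₂ := by
    have hi : ∀ i, (∑ I, ∑ J, entryVal T (i, I, J) * (powVec x I * powVec x J)) ^ 2
        = ∑ I₁, ∑ I₂, ∑ J₁, ∑ J₂, entryVal T (i, I₁, J₁) * entryVal T (i, I₂, J₂) *
          ((powVec x I₁ * powVec x I₂) * (powVec x J₁ * powVec x J₂)) := by
      intro i
      rw [sq, sum_mul_sum]
      refine sum_congr rfl fun I₁ _ => sum_congr rfl fun I₂ _ => ?_
      rw [sum_mul_sum]
      exact sum_congr rfl fun J₁ _ => sum_congr rfl fun J₂ _ => by ring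
    simp only [hi, hg, sum_mul]
    rw [sum_comm]
    refine sum_congr rfl fun I₁ _ => ?_
    rw [sum_comm]
    refine sum_congr rfl fun I₂ _ => ?_
    rw [sum_comm]
    refine sum_congr rfl fun J₁ _ => ?_
    rw [sum_comm]
  have h2 : ∑ I, ∑ J, diagFree T I J *
          ((powVec x I.1 * powVec x I.2) * (powVec x J.1 * powVec x J.2))
      = ∑ I₁, ∑ I₂, ∑ J₁, ∑ J₂, if (I₁, J₁) ≠ (I₂, J₂) then g I₁ I₂ J₁ J₂ else 0 := by
    rw [Fintype.sum_prod_type]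
    refine sum_congr rfl fun I₁ _ => sum_congr rfl fun I₂ _ => ?_
    rw [Fintype.sum_prod_type]
    refine sum_congr rfl fun J₁ _ => sum_congr rfl fun J₂ _ => ?_
    rw [diagFree_apply, ite_mul, zero_mul]
  have h3 : ∑ I, ∑ J, (∑ i, entryVal T (i, I, J) ^ 2) * (powVec x I ^ 2 * powVec x J ^ 2)
      = ∑ I₁, ∑ I₂, ∑ J₁, ∑ J₂, if (I₁, J₁) ≠ (I₂, J₂) then 0 else g I₁ I₂ J₁ J₂ := by
    refine sum_congr rfl fun I₁ _ => ?_
    rw [sum_comm (f := fun I₂ J₁ => ∑ J₂, if (I₁, J₁) ≠ (I₂, J₂) then 0 else g I₁ I₂ J₁ J₂)]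
    refine sum_congr rfl fun J₁ _ => ?_
    rw [sum_eq_single_of_mem I₁ (mem_univ _), sum_eq_single_of_mem J₁ (mem_univ _)]
    · simp only [ne_eq, not_true_eq_false, if_false, hg, sq]
    · intro J₂ _ h
      simp [h.symm]
    · intro I₂ _ h
      simp [h.symm]
  rw [h1, h2, h3]
  simp only [← sum_add_distrib]
  refine sum_congr rfl fun I₁ _ => sum_congr rfl fun I₂ _ => sum_congr rfl fun J₁ _ =>
    sum_congr rfl fun J₂ _ => ?_
  split_ifs <;> simp

theorem injNorm_le_certify (T : Tensor (2 * κ + 1) n) {d : ℕ} (hd : 1 ≤ d) :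
    injNorm T ≤ certify d T := by
  refine Real.iSup_le (fun x => ?_) (Real.sqrt_nonneg _)
  have hx : ∑ i, x.1 i ^ 2 = 1 := by
    have h := EuclideanSpace.real_norm_sq_eq x.1
    rw [← h, mem_sphere_zero_iff_norm.1 x.2, one_pow]
  set q := ∑ I, ∑ J, diagFree T I J *
    ((powVec x.1 I.1 * powVec x.1 I.2) * (powVec x.1 J.1 * powVec x.1 J.2)) with hq
  have hqd : q ^ d ≤ specNorm (certMatrix d T) := by
    rw [hq, ← quadForm_tensorPow, ← quadForm_symmetrize]
    exact quadForm_le_specNorm _ _ (sum_powVec_sq hx)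
  have hspec : 0 ≤ specNorm (certMatrix d T) := norm_nonneg _
  have hq1 : q ≤ specNorm (certMatrix d T) ^ (1 / (d : ℝ)) := by
    rcases le_total q 0 with h | h
    · exact h.trans (Real.rpow_nonneg hspec _)
    · calc q = (q ^ d) ^ (1 / (d : ℝ)) := by
            rw [one_div, Real.pow_rpow_inv_natCast h (by omega)]
        _ ≤ _ := Real.rpow_le_rpow (by positivity) hqd (by positivity)
  set D := ⨆ ab : (Fin κ → Fin n) × (Fin κ → Fin n),
      ∑ i : Fin n, OddTensor.slice (asymmetrize T) i ab.1 ab.2 ^ 2 with hD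
  have hdiag : ∑ I, ∑ J, (∑ i, entryVal T (i, I, J) ^ 2) * (powVec x.1 I ^ 2 * powVec x.1 J ^ 2)
      ≤ D := by
    calc _ ≤ ∑ I : Fin κ → Fin n, ∑ J : Fin κ → Fin n,
            D * (powVec x.1 I ^ 2 * powVec x.1 J ^ 2) := by
          refine sum_le_sum fun I _ => sum_le_sum fun J _ => ?_
          refine mul_le_mul_of_nonneg_right ?_ (by positivity)
          exact le_ciSup (f := fun ab : (Fin κ → Fin n) × (Fin κ → Fin n) =>
            ∑ i : Fin n, OddTensor.slice (asymmetrize T) i ab.1 ab.2 ^ 2)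
            (Set.finite_range _).bddAbove (I, J)
      _ = D := by
          simp only [← mul_sum]
          rw [sum_powVec_sq hx]
          simp only [mul_one]
          rw [sum_powVec_sq hx, mul_one]
  refine Real.abs_le_sqrt ?_
  rw [evalPow_eq_sum_slices]
  -- Cauchy–Schwarz over the slices
  calc _ ≤ (∑ i, x.1 i ^ 2) * ∑ i, (∑ I, ∑ J, entryVal T (i, I, J) *
          (powVec x.1 I * powVec x.1 J)) ^ 2 := sum_mul_sq_le_sq_mul_sq _ _ _
    _ = _ := by rw [hx, one_mul, sum_sq_quadForm]
    _ ≤ _ := add_le_add hq1 hdiag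

end Deterministic

/-! ### Bounds with high probability -/

section HighProbability

open MeasureTheory ProbabilityTheory Filter Topology

theorem tendsto_measure_of_measure_compl_le {Ω : ℕ → Type*} [∀ n, MeasurableSpace (Ω n)]
    {P : ∀ n, Measure (Ω n)} [∀ n, IsProbabilityMeasure (P n)] {G : ∀ n, Set (Ω n)} {ε : ℕ → ℝ}
    (hε : Tendsto ε atTop (𝓝 0)) (h : ∀ᶠ n in atTop, P n (G n)ᶜ ≤ ENNReal.ofReal (ε n)) :
    Tendsto (fun n => P n (G n)) atTop (𝓝 1) := by
  have h1 : Tendsto (fun n => 1 - ENNReal.ofReal (ε n)) atTop (𝓝 1) := by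
    have := ENNReal.Tendsto.sub (tendsto_const_nhds (x := (1 : ENNReal)) (f := atTop))
      (ENNReal.tendsto_ofReal hε) (Or.inl ENNReal.one_ne_top)
    simpa using this
  refine tendsto_of_tendsto_of_tendsto_of_le_of_le' h1 tendsto_const_nhds ?_
    (Eventually.of_forall fun n => prob_le_one)
  filter_upwards [h] with n hn
  refine tsub_le_iff_right.2 ?_
  calc (1 : ENNReal) = P n (G n ∪ (G n)ᶜ) := by rw [Set.union_compl_self, measure_univ]
    _ ≤ P n (G n) + P n (G n)ᶜ := measure_union_le _ _
    _ ≤ _ := by gcongr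

/-- A power of two of the order of `log n` that may serve as the length of the trace. -/
theorem eventually_exists_level (κ : ℕ) (hκ : 1 ≤ κ) {d : ℕ → ℕ}
    (hd : ∀ᶠ n : ℕ in atTop, (d n : ℝ) * Real.log n ≤ 2 * (n : ℝ) ^ (1 / 120 : ℝ)) :
    ∀ᶠ n : ℕ in atTop, 1 ≤ Real.log n ∧ ∃ s L : ℕ, L = 2 * 2 ^ (s + 1) ∧ Real.log n ≤ L ∧
      (L : ℝ) ≤ 16 * Real.log n ∧ (2 * n : ℝ) ≤ Real.exp (2 * L) ∧
      (2 * κ * (L * d n)) ^ 13 ≤ n ∧ d n ≤ n := by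
  have hlog : ∀ᶠ n : ℕ in atTop, 1 ≤ Real.log n :=
    (Real.tendsto_log_atTop.comp tendsto_natCast_atTop_atTop).eventually_ge_atTop 1
  have hpow : ∀ᶠ n : ℕ in atTop, (64 * κ : ℝ) ^ 13 ≤ (n : ℝ) ^ (107 / 120 : ℝ) :=
    ((tendsto_rpow_atTop (by norm_num : (0 : ℝ) < 107 / 120)).comp
      tendsto_natCast_atTop_atTop).eventually_ge_atTop _
  filter_upwards [hd, hlog, hpow, eventually_ge_atTop 1] with n h1 h2 h3 h4
  have hn : (1 : ℝ) ≤ n := by exact_mod_cast h4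
  refine ⟨h2, ?_⟩
  -- `2 ^ s` lies between `⌈log n⌉` and `2 ⌈log n⌉`, hence `L = 4 * 2 ^ s` between `4 log n` and
  -- `16 log n`
  set c := ⌈Real.log n⌉₊ with hc
  have hc1 : Real.log n ≤ c := Nat.le_ceil _
  have hc2 : (c : ℝ) < Real.log n + 1 := Nat.ceil_lt_add_one (by linarith)
  have hc0 : 1 ≤ c := by exact_mod_cast h2.trans hc1
  set s := Nat.clog 2 c with hs
  have hs1 : c ≤ 2 ^ s := Nat.le_pow_clog one_lt_two c
  have hs2 : 2 ^ s ≤ 2 * c := by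
    rcases Nat.lt_or_ge 1 c with h | h
    · have := Nat.pow_pred_clog_lt_self one_lt_two h
      have hpos : 0 < s := Nat.clog_pos one_lt_two h
      have he : 2 ^ s = 2 * 2 ^ s.pred := by
        rw [← pow_succ', ← Nat.succ_eq_add_one, Nat.succ_pred_eq_of_pos hpos]
      rw [hs] at he ⊢
      omega
    · have : c = 1 := le_antisymm h hc0
      rw [hs, this]
      simp
  have hs1' : (c : ℝ) ≤ 2 ^ s := by exact_mod_cast hs1
  have hs2' : (2 : ℝ) ^ s ≤ 2 * c := by exact_mod_cast hs2
  have hL : ((2 * 2 ^ (s + 1) : ℕ) : ℝ) = 4 * 2 ^ s := by push_cast; ring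
  -- the exponent `13 / 120` is less than one, with room for the constant
  have hLd : 2 * κ * (2 * 2 ^ (s + 1) * d n) ≤ n ∧ (2 * κ * (2 * 2 ^ (s + 1) * d n)) ^ 13 ≤ n := by
    have hX : ((2 * κ * (2 * 2 ^ (s + 1) * d n) : ℕ) : ℝ) ≤ 64 * κ * (n : ℝ) ^ (1 / 120 : ℝ) := by
      have e : ((2 * κ * (2 * 2 ^ (s + 1) * d n) : ℕ) : ℝ)
          = 2 * κ * ((2 * 2 ^ (s + 1) : ℕ) * d n) := by push_cast; ring
      rw [e, hL]
      calc (2 * κ * (4 * 2 ^ s * d n) : ℝ) ≤ 2 * κ * (16 * Real.log n * d n) := by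
            refine mul_le_mul_of_nonneg_left (mul_le_mul_of_nonneg_right ?_ (by positivity))
              (by positivity)
            linarith
        _ = 32 * κ * (d n * Real.log n) := by ring
        _ ≤ 32 * κ * (2 * (n : ℝ) ^ (1 / 120 : ℝ)) := by gcongr
        _ = _ := by ring
    have h13 : (2 * κ * (2 * 2 ^ (s + 1) * d n)) ^ 13 ≤ n := by
      have : (((2 * κ * (2 * 2 ^ (s + 1) * d n)) ^ 13 : ℕ) : ℝ) ≤ n := by
        rw [Nat.cast_pow]
        calc _ ≤ (64 * κ * (n : ℝ) ^ (1 / 120 : ℝ)) ^ 13 := by gcongr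
          _ = (64 * κ) ^ 13 * (n : ℝ) ^ (13 / 120 : ℝ) := by
              rw [mul_pow, ← Real.rpow_mul_natCast (by positivity)]
              norm_num
          _ ≤ (n : ℝ) ^ (107 / 120 : ℝ) * (n : ℝ) ^ (13 / 120 : ℝ) := by gcongr
          _ = n := by
              rw [← Real.rpow_add (by positivity)]
              norm_num
      exact_mod_cast this
    exact ⟨(Nat.le_self_pow (by norm_num) _).trans h13, h13⟩
  refine ⟨s, _, rfl, ?_, ?_, ?_, hLd.2, le_trans ?_ hLd.1⟩
  · rw [hL]; linarith
  · rw [hL]; linarith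
  · rw [hL]
    calc (2 * n : ℝ) ≤ Real.exp 1 * Real.exp (Real.log n) := by
          rw [Real.exp_log (by positivity)]
          have := Real.add_one_le_exp (1 : ℝ)
          gcongr
          linarith
      _ = Real.exp (1 + Real.log n) := (Real.exp_add _ _).symm
      _ ≤ _ := Real.exp_le_exp.2 (by linarith)
  · rw [← mul_assoc]
    exact Nat.le_mul_of_pos_left _ (by positivity)

variable {κ : ℕ} {v : ℝ≥0}

theorem normConst_pos : 0 < normConst κ v := by
  unfold normConst momentConst
  positivity

theorem eventually_measure_specNorm_gt_le (hκ : 1 ≤ κ) {d : ℕ → ℕ} (hd1 : ∀ n, 1 ≤ d n)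
    (hd : ∀ᶠ n : ℕ in atTop, (d n : ℝ) * Real.log n ≤ 2 * (n : ℝ) ^ (1 / 120 : ℝ))
    {Ω : ℕ → Type*} [∀ n, MeasurableSpace (Ω n)] {P : ∀ n, Measure (Ω n)}
    [∀ n, IsProbabilityMeasure (P n)] {A : ∀ n, Ω n → Tensor (2 * κ + 1) n}
    (hA : ∀ n, IsRandomTensor (P n) v (A n)) :
    ∀ᶠ n : ℕ in atTop, P n {ω | ¬ specNorm (certMatrix (d n) (A n ω)) ^ 2
        ≤ (16 * normConst κ v * Real.log n * ((n : ℝ) ^ (2 * κ + 1) / (d n : ℝ) ^ (2 * κ - 1)))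
            ^ d n} ≤ ENNReal.ofReal (Real.log n)⁻¹ := by
  filter_upwards [eventually_exists_level κ hκ hd] with n ⟨h1, s, L, hL, hL1, hL2, hexp, hn, _⟩
  have hc : 0 < normConst κ v := normConst_pos
  have hle : (normConst κ v * (L * (n : ℝ) ^ (2 * κ + 1) / (d n : ℝ) ^ (2 * κ - 1))) ^ d n
      ≤ (16 * normConst κ v * Real.log n * ((n : ℝ) ^ (2 * κ + 1) / (d n : ℝ) ^ (2 * κ - 1)))
          ^ d n := by
    refine pow_le_pow_left₀ (by positivity) ?_ _
    rw [mul_div_assoc]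
    calc _ ≤ normConst κ v * (16 * Real.log n
          * ((n : ℝ) ^ (2 * κ + 1) / (d n : ℝ) ^ (2 * κ - 1))) := by gcongr
      _ = _ := by ring
  have h2 : (L : ℝ) ≤ 2 ^ L := by exact_mod_cast Nat.lt_two_pow_self.le
  calc _ ≤ P n {ω | ¬ specNorm (certMatrix (d n) (A n ω)) ^ 2
        ≤ (normConst κ v * (L * (n : ℝ) ^ (2 * κ + 1) / (d n : ℝ) ^ (2 * κ - 1))) ^ d n} :=
        measure_mono <| Set.ofPred_subset_ofPred.2 fun ω hω h => hω (h.trans hle)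
    _ ≤ ENNReal.ofReal ((1 / 2) ^ L) := measure_specNorm_gt_le (hA n) hκ (hd1 n) hL hn hexp
    _ ≤ _ := by
        rw [one_div, inv_pow]
        exact ENNReal.ofReal_le_ofReal (inv_anti₀ (by linarith) (hL1.trans h2))

/-- An exponential tail bound. It also covers the proxy `v = 0`, for which the Gaussian exponent
`t² / (2 v)` has no meaning. -/
theorem measure_abs_gt_le {Ω : Type*} [MeasurableSpace Ω] {P : Measure Ω}
    [IsProbabilityMeasure P] {X : Ω → ℝ} (hX : HasSubgaussianMGF X v P) (t : ℝ) :
    P {ω | t < |X ω|} ≤ ENNReal.ofReal (2 * Real.exp (v / 2) * Real.exp (-t)) := by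
  have key : ∀ Y : Ω → ℝ, HasSubgaussianMGF Y v P →
      P {ω | t ≤ Y ω} ≤ ENNReal.ofReal (Real.exp (v / 2) * Real.exp (-t)) := by
    intro Y hY
    rw [← ofReal_measureReal]
    refine ENNReal.ofReal_le_ofReal ?_
    have h1 := measure_ge_le_exp_mul_mgf (μ := P) (X := Y) t zero_le_one (hY.integrable_exp_mul 1)
    have h2 := hY.mgf_le 1
    rw [one_pow, mul_one] at h2
    rw [neg_one_mul] at h1
    rw [mul_comm]
    exact h1.trans (by gcongr)
  calc P {ω | t < |X ω|} ≤ P ({ω | t ≤ X ω} ∪ {ω | t ≤ (-X) ω}) := by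
        refine measure_mono fun ω hω => ?_
        rcases lt_abs.1 (show t < |X ω| from hω) with h | h
        · exact Or.inl h.le
        · exact Or.inr h.le
    _ ≤ _ := measure_union_le _ _
    _ ≤ _ := add_le_add (key X hX) (key (-X) hX.neg)
    _ = _ := by
        rw [← ENNReal.ofReal_add (by positivity) (by positivity)]
        congr 1
        ring

/-- With high probability all entries of a random tensor are of the order of `log n`, by a union
bound over the `n ^ k` entries. -/
theorem measure_exists_abs_gt_le {Ω : Type*} [MeasurableSpace Ω] {P : Measure Ω}
    [IsProbabilityMeasure P] {n : ℕ} (hn : 1 ≤ n) {A : Ω → Tensor (2 * κ + 1) n}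
    (hA : IsRandomTensor P v A) :
    P {ω | ∃ S, (2 * κ + 2 : ℕ) * Real.log n < |A ω S|}
      ≤ ENNReal.ofReal (2 * Real.exp (v / 2) * (n : ℝ)⁻¹) := by
  have hn' : (0 : ℝ) < n := by exact_mod_cast hn
  have hexp : Real.exp (-((2 * κ + 2 : ℕ) * Real.log n)) = ((n : ℝ) ^ (2 * κ + 2))⁻¹ := by
    rw [Real.exp_neg, Real.exp_nat_mul, Real.exp_log hn']
  rw [Set.ofPred_exists]
  refine (measure_iUnion_fintype_le _ _).trans ?_
  refine (sum_le_sum fun S _ => measure_abs_gt_le (hA.subgaussian S) _).trans_eq ?_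
  rw [sum_const, card_univ, Fintype.card_fun, Fintype.card_fin, Fintype.card_fin, hexp,
    ← ENNReal.ofReal_nsmul]
  congr 1
  rw [nsmul_eq_mul]
  push_cast
  field_simp
  ring

theorem iSup_sum_slice_sq_le {n : ℕ} {T : Tensor (2 * κ + 1) n} (hT : IsSymmetric T) {t : ℝ}
    (ht : 0 ≤ t) (h : ∀ S, |T S| ≤ t) :
    ⨆ ab : (Fin κ → Fin n) × (Fin κ → Fin n),
      ∑ i : Fin n, OddTensor.slice (asymmetrize T) i ab.1 ab.2 ^ 2
      ≤ n * ((2 * κ + 1).factorial * t) ^ 2 := by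
  classical
  refine Real.iSup_le (fun ab => ?_) (by positivity)
  have hS : ∀ S, |asymmetrize T S| ≤ (2 * κ + 1).factorial * t := by
    intro S
    rw [asymmetrize_of_isSymmetric hT]
    split_ifs
    · rw [abs_mul, Nat.abs_cast]
      have h2 : (numRearr S : ℝ) ≤ (2 * κ + 1).factorial := by exact_mod_cast numRearr_le S
      exact mul_le_mul h2 (h S) (abs_nonneg _) (by positivity)
    · rw [abs_zero]; positivity
  calc _ ≤ ∑ _i : Fin n, ((2 * κ + 1).factorial * t) ^ 2 := by
        refine sum_le_sum fun i _ => ?_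
        rw [← sq_abs]
        exact pow_le_pow_left₀ (abs_nonneg _) (hS _) 2
    _ = _ := by simp

theorem le_const_mul_log_rpow {b l : ℝ} (hb : 0 ≤ b) (hl : 1 ≤ l) {C : ℝ} (hC : b + 1 ≤ C) :
    b * l ^ 2 ≤ (C * l ^ C) ^ 2 := by
  have h1 : l ≤ l ^ C := by
    calc l = l ^ (1 : ℝ) := (Real.rpow_one l).symm
      _ ≤ _ := Real.rpow_le_rpow_of_exponent_le hl (by linarith)
  rw [mul_pow]
  have : b ≤ C ^ 2 := by nlinarith
  gcongr

/-- The form of the norm bound with a power of `d` that is at most `(k - 2) / 2`; one constant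
serves as factor and as exponent of the logarithm. -/
theorem specNorm_le_of_sq_le {n d : ℕ} (hκ : 1 ≤ κ) (hd : 1 ≤ d) (hl : 1 ≤ Real.log n)
    {x c a C : ℝ} (hc : 0 ≤ c) (ha : a ≤ ((2 * κ + 1 : ℝ) - 2) / 2) (hC : c + 1 ≤ C)
    (h : x ^ 2 ≤ (c * Real.log n * ((n : ℝ) ^ (2 * κ + 1) / (d : ℝ) ^ (2 * κ - 1))) ^ d) :
    x ≤ (C * Real.log n ^ C * ((n : ℝ) ^ ((2 * κ + 1 : ℝ) / 2) / (d : ℝ) ^ a)) ^ d := by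
  have hd' : (1 : ℝ) ≤ d := by exact_mod_cast hd
  have hC0 : 0 ≤ C := by linarith
  refine le_of_sq_le_sq ?_ (by positivity)
  refine h.trans ?_
  rw [← pow_mul, mul_comm d, pow_mul]
  refine pow_le_pow_left₀ (by positivity) ?_ d
  rw [mul_pow _ (_ / _)]
  have hn2 : ((n : ℝ) ^ ((2 * κ + 1 : ℝ) / 2)) ^ 2 = (n : ℝ) ^ (2 * κ + 1) := by
    rw [← Real.rpow_mul_natCast (by positivity), ← Real.rpow_natCast]
    congr 1
    push_cast
    ring
  have hd2 : ((d : ℝ) ^ a) ^ 2 ≤ (d : ℝ) ^ (2 * κ - 1) := by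
    rw [← Real.rpow_mul_natCast (by positivity), ← Real.rpow_natCast]
    refine Real.rpow_le_rpow_of_exponent_le hd' ?_
    rw [Nat.cast_sub (by omega)]
    push_cast
    linarith
  rw [div_pow, hn2]
  have h1 : c * Real.log n ≤ (C * Real.log n ^ C) ^ 2 := by
    refine le_trans ?_ (le_const_mul_log_rpow hc hl hC)
    nlinarith [mul_nonneg hc (mul_nonneg (zero_le_one.trans hl) (sub_nonneg.2 hl))]
  gcongr

/-- The bound on the output from bounds on its two terms. -/
theorem certify_le_of_sq_le {n d : ℕ} (hκ : 1 ≤ κ) (hd : 1 ≤ d) (hdn : d ≤ n)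
    (hl : 1 ≤ Real.log n) {T : Tensor (2 * κ + 1) n} {c b C D : ℝ} (hc : 0 ≤ c) (hb : 0 ≤ b)
    (hC : c + 1 + b + 1 ≤ C) (hD : 1 ≤ D)
    (hspec : specNorm (certMatrix d T) ^ 2
      ≤ (c * Real.log n * ((n : ℝ) ^ (2 * κ + 1) / (d : ℝ) ^ (2 * κ - 1))) ^ d)
    (hsup : ⨆ ab : (Fin κ → Fin n) × (Fin κ → Fin n),
      ∑ i : Fin n, OddTensor.slice (asymmetrize T) i ab.1 ab.2 ^ 2 ≤ n * (b * Real.log n ^ 2)) :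
    certify d T ≤ C * Real.log n ^ C * ((n : ℝ) ^ ((2 * κ + 1 : ℝ) / 4)
      / (d : ℝ) ^ (((2 * κ + 1 : ℝ) - 2) / 4) * D) := by
  have hd' : (1 : ℝ) ≤ d := by exact_mod_cast hd
  have hdn' : (d : ℝ) ≤ n := by exact_mod_cast hdn
  have hn0 : (0 : ℝ) < n := by linarith
  have hC0 : 0 ≤ C := by linarith
  set W := (n : ℝ) ^ ((2 * κ + 1 : ℝ) / 4) / (d : ℝ) ^ (((2 * κ + 1 : ℝ) - 2) / 4) with hW
  have hW0 : 0 ≤ W := by positivity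
  have hW4 : W ^ 4 = (n : ℝ) ^ (2 * κ + 1) / (d : ℝ) ^ (2 * κ - 1) := by
    rw [hW, div_pow, ← Real.rpow_mul_natCast (by positivity), ← Real.rpow_mul_natCast
      (by positivity), ← Real.rpow_natCast _ (2 * κ + 1), ← Real.rpow_natCast _ (2 * κ - 1),
      Nat.cast_sub (by omega)]
    push_cast
    congr 2 <;> ring
  -- `d ≤ n`, so that the diagonal term of order `n` is at most `n ^ (k / 2) / d ^ ((k - 2) / 2)`
  have hnW : (n : ℝ) ≤ W ^ 2 := by
    refine le_of_sq_le_sq ?_ (by positivity)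
    rw [← pow_mul, hW4, le_div_iff₀ (by positivity)]
    calc (n : ℝ) ^ 2 * (d : ℝ) ^ (2 * κ - 1) ≤ (n : ℝ) ^ 2 * (n : ℝ) ^ (2 * κ - 1) := by gcongr
      _ = _ := by rw [← pow_add]; congr 1; omega
  have h0 : 0 ≤ specNorm (certMatrix d T) := norm_nonneg _
  have hl0 : 0 ≤ Real.log n := by linarith
  have hroot : specNorm (certMatrix d T) ^ (1 / (d : ℝ)) ≤ (c + 1) * Real.log n ^ 2 * W ^ 2 := by
    have h1 : specNorm (certMatrix d T) ≤ ((c + 1) * Real.log n ^ 2 * W ^ 2) ^ d := by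
      refine le_of_sq_le_sq (hspec.trans ?_) (by positivity)
      rw [← pow_mul, mul_comm d, pow_mul]
      refine pow_le_pow_left₀ (by positivity) ?_ d
      rw [← hW4]
      calc c * Real.log n * W ^ 4 ≤ (c + 1) ^ 2 * Real.log n ^ 4 * W ^ 4 := by
            have : Real.log n ≤ Real.log n ^ 4 := le_self_pow₀ hl (by norm_num)
            have : c ≤ (c + 1) ^ 2 := by nlinarith
            gcongr
        _ = _ := by ring
    calc _ ≤ (((c + 1) * Real.log n ^ 2 * W ^ 2) ^ d) ^ (1 / (d : ℝ)) :=
          Real.rpow_le_rpow h0 h1 (by positivity)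
      _ = _ := by rw [one_div, Real.pow_rpow_inv_natCast (by positivity) (by omega)]
  refine Real.sqrt_le_iff.2 ⟨by positivity, ?_⟩
  calc _ ≤ (c + 1) * Real.log n ^ 2 * W ^ 2 + W ^ 2 * (b * Real.log n ^ 2) :=
        add_le_add hroot (hsup.trans (by gcongr))
    _ = ((c + 1 + b) * Real.log n ^ 2) * W ^ 2 := by ring
    _ ≤ (C * Real.log n ^ C) ^ 2 * (W * D) ^ 2 := by
        have h1 := le_const_mul_log_rpow (b := c + 1 + b) (by positivity) hl hC
        have h2 : W ≤ W * D := le_mul_of_one_le_right hW0 hD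
        gcongr
    _ = _ := (mul_pow _ _ _).symm

end HighProbability

end OddTensor

theorem mainTheorem6 (κ k : ℕ) (hκ : 1 ≤ κ) (hk : k = 2 * κ + 1) :
    -- the output is an upper bound on the injective norm, for every symmetric tensor
    (∀ (n d : ℕ) (T : OddTensor.Tensor (2 * κ + 1) n), 1 ≤ d → OddTensor.IsSymmetric T →
      OddTensor.injNorm T ≤ OddTensor.certify d T) ∧
    -- with high probability the output is small
    (∀ v : ℝ≥0, ∃ C : ℝ, 0 < C ∧
      ∀ d : ℕ → ℕ, (∀ n, 1 ≤ d n) →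
      (fun n : ℕ => (d n : ℝ) * Real.log n) =o[Filter.atTop]
        (fun n : ℕ => (n : ℝ) ^ (1 / 120 : ℝ)) →
      ∀ (Ω : ℕ → Type*) [∀ n, MeasurableSpace (Ω n)]
        (P : ∀ n, MeasureTheory.Measure (Ω n)) [∀ n, MeasureTheory.IsProbabilityMeasure (P n)]
        (A : ∀ n, Ω n → OddTensor.Tensor (2 * κ + 1) n),
      (∀ n, OddTensor.IsRandomTensor (P n) v (A n)) →
      Filter.Tendsto (fun n : ℕ => P n {ω | OddTensor.certify (d n) (A n ω) ≤
          C * Real.log n ^ C *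
            ((n : ℝ) ^ ((k : ℝ) / 4) / (d n : ℝ) ^ (((k : ℝ) - 2) / 4) *
              (d n : ℝ) ^ ((k : ℝ) ^ 2 * Real.log (d n) / (2 * Real.log n)))})
        Filter.atTop (nhds 1)) ∧
    -- with high probability the certificate matrix has small norm, for each fixed `β`
    (∀ (v : ℝ≥0) (β : ℝ), 0 < β → β < 1 / 30 → ∃ C : ℝ, 0 < C ∧
      ∀ d : ℕ → ℕ, (∀ n, 1 ≤ d n) →
      (∀ᶠ n : ℕ in Filter.atTop,
        (k : ℝ) * (d n : ℝ) * Real.log n < 4 * (n : ℝ) ^ (β / 4)) →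
      ∀ (Ω : ℕ → Type*) [∀ n, MeasurableSpace (Ω n)]
        (P : ∀ n, MeasureTheory.Measure (Ω n)) [∀ n, MeasureTheory.IsProbabilityMeasure (P n)]
        (A : ∀ n, Ω n → OddTensor.Tensor (2 * κ + 1) n),
      (∀ n, OddTensor.IsRandomTensor (P n) v (A n)) →
      Filter.Tendsto (fun n : ℕ => P n {ω |
          OddTensor.specNorm (OddTensor.certMatrix (d n) (A n ω)) ≤
          (C * Real.log n ^ C *
            ((n : ℝ) ^ ((k : ℝ) / 2) /
              (d n : ℝ) ^ (((k : ℝ) - 2) / 2 - 4 * (κ : ℝ) ^ 2 * β))) ^ d n})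
        Filter.atTop (nhds 1)) := by
  subst hk
  have hcast : ((2 * κ + 1 : ℕ) : ℝ) = 2 * κ + 1 := by push_cast; ring
  have hlog : Filter.Tendsto (fun n : ℕ => Real.log n) Filter.atTop Filter.atTop :=
    Real.tendsto_log_atTop.comp tendsto_natCast_atTop_atTop
  have hlog1 : ∀ᶠ n : ℕ in Filter.atTop, 1 ≤ Real.log n := hlog.eventually_ge_atTop 1
  rw [hcast]
  refine ⟨fun n d T hd _ => OddTensor.injNorm_le_certify T hd, fun v => ?_, fun v β hβ hβ' => ?_⟩
  · set c := 16 * OddTensor.normConst κ v with hc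
    set b := ((2 * κ + 1).factorial * (2 * κ + 2 : ℕ) : ℝ) ^ 2 with hb
    have hc0 : 0 < c := mul_pos (by norm_num) OddTensor.normConst_pos
    have hb0 : 0 ≤ b := sq_nonneg _
    -- `c` bounds the norm term and `b` the diagonal term
    refine ⟨c + 1 + b + 1, by positivity, fun d hd1 hd Ω _ P _ A hA => ?_⟩
    have hd2 : ∀ᶠ n : ℕ in Filter.atTop,
        (d n : ℝ) * Real.log n ≤ 2 * (n : ℝ) ^ (1 / 120 : ℝ) := by
      filter_upwards [hd.bound (by norm_num : (0 : ℝ) < 2)] with n h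
      rw [Real.norm_eq_abs, Real.norm_eq_abs, Real.abs_rpow_of_nonneg (Nat.cast_nonneg n),
        Nat.abs_cast]
        at h
      exact (le_abs_self _).trans h
    have hε : Filter.Tendsto (fun n : ℕ => (Real.log n)⁻¹ + 2 * Real.exp (v / 2) * (n : ℝ)⁻¹)
        Filter.atTop (nhds 0) := by
      have h1 := hlog.inv_tendsto_atTop
      have h2 := (tendsto_natCast_atTop_atTop (R := ℝ)).inv_tendsto_atTop.const_mul
        (2 * Real.exp (v / 2))
      simpa using h1.add h2
    refine OddTensor.tendsto_measure_of_measure_compl_le hε ?_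
    filter_upwards [OddTensor.eventually_measure_specNorm_gt_le hκ hd1 hd2 hA,
      OddTensor.eventually_exists_level κ hκ hd2, Filter.eventually_ge_atTop 1]
      with n h1 ⟨hl, _, _, _, _, _, _, _, hdn⟩ hn
    have h2 := OddTensor.measure_exists_abs_gt_le hn (hA n)
    have hD : (1 : ℝ) ≤ (d n : ℝ) ^ ((2 * κ + 1 : ℝ) ^ 2 * Real.log (d n) / (2 * Real.log n)) := by
      refine Real.one_le_rpow (by exact_mod_cast hd1 n) ?_
      have : 0 ≤ Real.log (d n) := Real.log_natCast_nonneg _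
      positivity
    rw [ENNReal.ofReal_add (by positivity) (by positivity)]
    refine le_trans ?_ (add_le_add h1 h2)
    refine (MeasureTheory.measure_mono ?_).trans (MeasureTheory.measure_union_le _ _)
    intro ω hω
    by_contra hgood
    obtain ⟨hg1, hg2⟩ := not_or.1 hgood
    refine hω (OddTensor.certify_le_of_sq_le hκ (hd1 n) hdn hl hc0.le hb0 le_rfl hD
      (not_not.1 hg1) ?_)
    have hall : ∀ S, |A n ω S| ≤ (2 * κ + 2 : ℕ) * Real.log n :=
      fun S => not_lt.1 fun h => hg2 ⟨S, h⟩
    refine (OddTensor.iSup_sum_slice_sq_le ((hA n).symmetric ω) (by positivity) hall).trans_eq ?_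
    rw [hb]
    ring
  · set c := 16 * OddTensor.normConst κ v with hc
    have hc0 : 0 < c := mul_pos (by norm_num) OddTensor.normConst_pos
    refine ⟨c + 1, by positivity, fun d hd1 hd Ω _ P _ A hA => ?_⟩
    have hd2 : ∀ᶠ n : ℕ in Filter.atTop,
        (d n : ℝ) * Real.log n ≤ 2 * (n : ℝ) ^ (1 / 120 : ℝ) := by
      filter_upwards [hd, hlog1, Filter.eventually_ge_atTop 1] with n h hl hn
      have hn' : (1 : ℝ) ≤ n := by exact_mod_cast hn
      have hκ' : (1 : ℝ) ≤ κ := by exact_mod_cast hκ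
      -- `β < 1 / 30` brings this range of `d` into the one of the bound on the output
      have hpow : (n : ℝ) ^ (β / 4) ≤ (n : ℝ) ^ (1 / 120 : ℝ) :=
        Real.rpow_le_rpow_of_exponent_le hn' (by linarith)
      have h0 : 0 ≤ (d n : ℝ) * Real.log n := by positivity
      nlinarith [mul_nonneg (sub_nonneg.2 hκ') h0]
    refine OddTensor.tendsto_measure_of_measure_compl_le hlog.inv_tendsto_atTop ?_
    filter_upwards [OddTensor.eventually_measure_specNorm_gt_le hκ hd1 hd2 hA, hlog1] with n h1 hl
    refine le_trans (MeasureTheory.measure_mono fun ω hω => ?_) h1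
    refine fun h => hω (OddTensor.specNorm_le_of_sq_le hκ (hd1 n) hl hc0.le ?_ le_rfl h)
    have : 0 ≤ 4 * (κ : ℝ) ^ 2 * β := by positivity
    linarith
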